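/- Let $n\ge 1$ and $m\ge 0$ be integers, let $\mathcal S^n$ be the space of real symmetric $n\times n$ matrices with the inner product $\langle x,y\rangle=\operatorname{trace}(xy)$, let $\mathcal S^n_+\subseteq\mathcal S^n$ be the cone of positive semidefinite matrices, and let $a_1,\dots,a_m,b\in\mathcal S^n$ and $c\in\mathbb R^m$. Put $Ax=\sum_{i=1}^m x_ia_i$ and $A^*y=(\langle a_1,y\rangle,\dots,\langle a_m,y\rangle)^T$, and consider the systems $$(P)\quad b-Ax\in\mathcal S^n_+ ,\qquad\qquad (D)\quad A^*y=c,\ \ y\in\mathcal S^n_+ ,$$ that is, the constraints of the semidefinite programs $\sup\{c^Tx: Ax\preceq b\}$ and $\inf\{\langle b,y\rangle: A^*y=c,\ y\succeq0\}$. Call $(P)$ strongly infeasible if there is $y\in\mathcal S^n_+$ with $A^*y=0$ and $\langle b,y\rangle=-1$, and call $(D)$ strongly infeasible if there is $x\in\mathbb R^m$ with $Ax\in\mathcal S^n_+$ and $c^Tx=-1$. A reformulation of the data $(a_1,\dots,a_m,b,c)$ is obtained by a finite sequence of the following operations: (i) replace $(a_i,c_i)$ by $(A\lambda,c^T\lambda)$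 for some $i$ and some $\lambda\in\mathbb R^m$ with $\lambda_i\ne0$; (ii) exchange $(a_i,c_i)$ and $(a_j,c_j)$ for some $i\neq j$; (iii) replace $b$ by $b+A\mu$ for some $\mu\in\mathbb R^m$; (iv) replace $a_1,\dots,a_m,b$ by $Ta_1,\dots,Ta_m,Tb$, where $T:\mathcal S^n\to\mathcal S^n$ is linear and invertible with $T(\mathcal S^n_+)=\mathcal S^n_+$. A map $T(x)=t^Txt$ with $t$ an invertible $n\times n$ matrix is called a rotation. Reformulated data are denoted by $a_i',b',c'$, with operators $A'$, $A'^{*}$. A sequence $(y_1,\dots,y_k)$ in $\mathcal S^n$ belongs to $\operatorname{REGFR}_k$ if there are integers $p_1,\dots,p_k\ge0$ with $p_1+\dots+p_k\le n$ such that, for each $i$, the lower right block of $y_i$ of order $n-p_1-\dots-p_{i-1}$ equals $\begin{pmatrix} I_{p_i}&0\\0&0\end{pmatrix}$, the other entries of $y_i$ being arbitrary. With $F_{i-1}=\{x\in\mathcal S^n_+:\langle y_1,x\rangle=\dots=\langle y_{i-1},x\rangle=0\}$, a sequence $(y_1,\dots,y_k)$ is a facial reduction sequence if, for every $i=1,\dots,k$,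 $\langle y_i,x\rangle\ge0$ for all $x\in F_{i-1}$; it is strict if moreover, for every $i=1,\dots,k$, $\langle y_i,x\rangle>0$ for some $x\in F_{i-1}$. A facial reduction sequence is pre-strict if it is strict after removal of its last member. Then the following hold. 1. $(D)$ is infeasible if and only if there are a reformulation and an integer $k$ with $0\le k\le m-1$ such that $c'_1=\dots=c'_k=0$, $c'_{k+1}=-1$ and $(a'_1,\dots,a'_{k+1})\in\operatorname{REGFR}_{k+1}$. 2. $(D)$ is not strongly infeasible if and only if there are a reformulation, an integer $\ell\ge0$ and $(y_1,\dots,y_{\ell+1})\in\operatorname{REGFR}_{\ell+1}$ such that $A'^{*}y_i=0$ for $i=1,\dots,\ell$ and $A'^{*}y_{\ell+1}=c'$. 3. $(P)$ is infeasible if and only if there are a reformulation, an integer $k\ge0$ and $(y_1,\dots,y_{k+1})\in\operatorname{REGFR}_{k+1}$ such that $A'^{*}y_i=0$ and $\langle b',y_i\rangle=0$ for $i=1,\dots,k$, and $A'^{*}y_{k+1}=0$ and $\langle b',y_{k+1}\rangle=-1$. 4. $(P)$ is not strongly infeasible if and only if there are a reformulation and an integer $\ell$ with $0\le\ell\le m$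 such that $(a'_1,\dots,a'_\ell,b')\in\operatorname{REGFR}_{\ell+1}$. Moreover, in the "only if" direction of each part the sequence in $\operatorname{REGFR}$ can be chosen pre-strict with $k\le n-1$, respectively $\ell\le n-1$, and the reformulation can be chosen so that all maps $T$ used in (iv) are rotations. -/

import Mathlib

namespace SDPCert

/-- The space of real symmetric matrices of order `n`. -/
def SymMat (n : ℕ) : Submodule ℝ (Matrix (Fin n) (Fin n) ℝ) where
  carrier := {x | x.IsSymm}
  add_mem' hx hy := hx.add hy
  zero_mem' := Matrix.isSymm_zero
  smul_mem' r _ hx := hx.smul r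

/-- The trace inner product of two symmetric matrices. -/
noncomputable def ip {n : ℕ} (x y : SymMat n) : ℝ :=
  Matrix.trace ((x : Matrix (Fin n) (Fin n) ℝ) * (y : Matrix (Fin n) (Fin n) ℝ))

/-- The cone of positive semidefinite matrices of order `n`. -/
def psd (n : ℕ) : Set (SymMat n) :=
  {x | (x : Matrix (Fin n) (Fin n) ℝ).PosSemidef}

/-- The dual cone of a set of symmetric matrices. -/
def dualCone {n : ℕ} (K : Set (SymMat n)) : Set (SymMat n) :=
  {y | ∀ x ∈ K, 0 ≤ ip y x}

/-- The orthogonal complement of a set of symmetric matrices. -/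
def orth {n : ℕ} (K : Set (SymMat n)) : Set (SymMat n) :=
  {y | ∀ x ∈ K, ip y x = 0}

/-- The part of `K` orthogonal to all members of the sequence `y` that precede the `i`-th one. -/
def cutBefore {n k : ℕ} (K : Set (SymMat n)) (y : Fin k → SymMat n) (i : Fin k) :
    Set (SymMat n) :=
  {x | x ∈ K ∧ ∀ j, j < i → ip (y j) x = 0}

/-- Facial reduction sequences of order `k` for the cone `K`. -/
def IsFR {n k : ℕ} (K : Set (SymMat n)) (y : Fin k → SymMat n) : Prop :=
  ∀ i, y i ∈ dualCone (cutBefore K y i)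

/-- Strict facial reduction sequences: every member, the first one included, lies in the dual
of the preceding intersection but not in its orthogonal complement. -/
def IsStrict {n k : ℕ} (K : Set (SymMat n)) (y : Fin k → SymMat n) : Prop :=
  ∀ i, y i ∈ dualCone (cutBefore K y i) \ orth (cutBefore K y i)

/-- Pre-strict facial reduction sequences: strict after the last member is removed. -/
def IsPreStrict {n k : ℕ} (K : Set (SymMat n)) (y : Fin (k + 1) → SymMat n) : Prop :=
  IsFR K y ∧ IsStrict K (fun i : Fin k => y i.castSucc)

/-- Regularized facial reduction sequences for the positive semidefinite cone, with block sizes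
`p i`. With `q` the sum of the block sizes before the `i`-th one, the lower right block of `y i`
of order `n - q` is the block diagonal matrix with blocks an identity of order `p i` and zero;
the other entries of `y i` are arbitrary. -/
def IsRegFR {n k : ℕ} (y : Fin k → SymMat n) : Prop :=
  ∃ p : Fin k → ℕ, ∑ i, p i ≤ n ∧
    ∀ (i : Fin k) (r s : Fin n),
      ∑ j ∈ Finset.Iio i, p j ≤ (r : ℕ) → ∑ j ∈ Finset.Iio i, p j ≤ (s : ℕ) →
        (y i : Matrix (Fin n) (Fin n) ℝ) r s =
          if r = s ∧ (r : ℕ) < (∑ j ∈ Finset.Iio i, p j) + p i then 1 else 0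

/-- The data of the primal-dual pair of semidefinite programs: maximize `∑ i, c i * x i` subject
to `b - ∑ i, x i • a i` being positive semidefinite, and minimize `ip b y` subject to
`ip (a i) y = c i` for all `i` with `y` positive semidefinite. -/
structure SDPData (m n : ℕ) where
  a : Fin m → SymMat n
  b : SymMat n
  c : Fin m → ℝ

namespace SDPData

variable {m n : ℕ}

/-- The operator `A` of the primal problem. -/
noncomputable def op (P : SDPData m n) (x : Fin m → ℝ) : SymMat n :=
  ∑ i, x i • P.a i

/-- The adjoint of the operator `A`. -/
noncomputable def adj (P : SDPData m n) (y : SymMat n) : Fin m → ℝ :=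
  fun i => ip (P.a i) y

/-- The primal system is feasible. -/
def PrimalFeasible (P : SDPData m n) : Prop :=
  ∃ x : Fin m → ℝ, P.b - P.op x ∈ psd n

/-- The dual system is feasible. -/
def DualFeasible (P : SDPData m n) : Prop :=
  ∃ y ∈ psd n, P.adj y = P.c

/-- The primal system is strongly infeasible: its alternative system is feasible. -/
def PrimalStronglyInfeasible (P : SDPData m n) : Prop :=
  ∃ y ∈ psd n, P.adj y = 0 ∧ ip P.b y = -1

/-- The dual system is strongly infeasible: its alternative system is feasible. -/
def DualStronglyInfeasible (P : SDPData m n) : Prop :=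
  ∃ x : Fin m → ℝ, P.op x ∈ psd n ∧ ∑ i, P.c i * x i = -1

/-- The first `k` of the matrices `a i`. -/
def lead (P : SDPData m n) (k : ℕ) (h : k ≤ m) : Fin k → SymMat n :=
  fun i => P.a (Fin.castLE h i)

/-- One operation of a reformulation, where the linear maps that may be applied to all the
matrices are those in `𝒯`. -/
inductive Step (𝒯 : Set (SymMat n ≃ₗ[ℝ] SymMat n)) : SDPData m n → SDPData m n → Prop
  | combine (P : SDPData m n) (i : Fin m) (l : Fin m → ℝ) (hl : l i ≠ 0) :
      Step 𝒯 P ⟨Function.update P.a i (P.op l), P.b,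
        Function.update P.c i (∑ j, P.c j * l j)⟩
  | swap (P : SDPData m n) (i j : Fin m) (hij : i ≠ j) :
      Step 𝒯 P ⟨fun r => P.a (Equiv.swap i j r), P.b, fun r => P.c (Equiv.swap i j r)⟩
  | shift (P : SDPData m n) (μ : Fin m → ℝ) :
      Step 𝒯 P ⟨P.a, P.b + P.op μ, P.c⟩
  | transform (P : SDPData m n) (T : SymMat n ≃ₗ[ℝ] SymMat n) (hT : T ∈ 𝒯) :
      Step 𝒯 P ⟨fun i => T (P.a i), T P.b, P.c⟩

end SDPData

/-- The automorphism group of the positive semidefinite cone. -/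
def psdAut (n : ℕ) : Set (SymMat n ≃ₗ[ℝ] SymMat n) :=
  {T | T '' psd n = psd n}

/-- The rotations, that is the maps `x ↦ tᵀ * x * t` with `t` an invertible matrix. -/
def rotations (n : ℕ) : Set (SymMat n ≃ₗ[ℝ] SymMat n) :=
  {T | ∃ t : Matrix (Fin n) (Fin n) ℝ, IsUnit t ∧
    ∀ x : SymMat n, (T x : Matrix (Fin n) (Fin n) ℝ) =
      t.transpose * (x : Matrix (Fin n) (Fin n) ℝ) * t}

/-- `Q` is a reformulation of `P`: a finite sequence of elementary row operations and of
automorphisms of the positive semidefinite cone leads from `P` to `Q`. -/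
def SDPData.IsReformulation {m n : ℕ} (P Q : SDPData m n) : Prop :=
  Relation.ReflTransGen (SDPData.Step (psdAut n)) P Q

/-- `Q` is a reformulation of `P` obtained by elementary row operations and rotations only. -/
def SDPData.IsRotReformulation {m n : ℕ} (P Q : SDPData m n) : Prop :=
  Relation.ReflTransGen (SDPData.Step (rotations n)) P Q

/-- The first `k` right-hand sides of the dual system are `0` and the next one is `-1`, while the
first `k + 1` matrices form a regularized facial reduction sequence. -/
def SDPData.IsDualRef {m n : ℕ} (Q : SDPData m n) (k : ℕ) (hk : k + 1 ≤ m) : Prop :=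
  (∀ i : Fin k, Q.c (Fin.castLE hk i.castSucc) = 0) ∧
    Q.c (Fin.castLE hk (Fin.last k)) = -1 ∧
    IsRegFR (Q.lead (k + 1) hk)

/-- The sequence formed by the first `l` of the matrices `a i`, followed by `b`. -/
def SDPData.leadSnoc {m n : ℕ} (Q : SDPData m n) (l : ℕ) (hl : l ≤ m) : Fin (l + 1) → SymMat n :=
  Fin.snoc (α := fun _ => SymMat n) (Q.lead l hl) Q.b

/-- The sequence `y` is regularized, the adjoint of `Q` maps all members but the last to `0`, and
maps the last one to the right-hand side of the dual system. -/
def SDPData.IsDualNotStrongCert {m n : ℕ} (Q : SDPData m n) {l : ℕ}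
    (y : Fin (l + 1) → SymMat n) : Prop :=
  IsRegFR y ∧ (∀ i : Fin l, Q.adj (y i.castSucc) = 0) ∧ Q.adj (y (Fin.last l)) = Q.c

/-- The sequence `y` is regularized, the adjoint of `Q` maps all members to `0`, and the inner
product with `b` is `0` for all members but the last, and `-1` for the last one. -/
def SDPData.IsPrimalInfeasCert {m n : ℕ} (Q : SDPData m n) {k : ℕ}
    (y : Fin (k + 1) → SymMat n) : Prop :=
  IsRegFR y ∧ (∀ i : Fin k, Q.adj (y i.castSucc) = 0 ∧ ip Q.b (y i.castSucc) = 0) ∧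
    Q.adj (y (Fin.last k)) = 0 ∧ ip Q.b (y (Fin.last k)) = -1

end SDPCert

open SDPCert

/-! Each "only if" direction comes down to one situation: a linear functional `z` is nonnegative on
`L ∩ psd n` for some subspace `L`. For infeasible (D), `L` is the orthogonal complement of `{Ax :
cᵀx = 0}` and `z = ⟨Ax₀, ·⟩` with `cᵀx₀ = -1`. For (P) not strongly infeasible, `L = ker A*` and `z
= ⟨b, ·⟩`. For (D) not strongly infeasible, `L = range A` and `z(Ax) = cᵀx`. For infeasible (P), `L
= range A + ℝb`, with `z = 0` on `range A` and `z(b) = -1`.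

If `L` meets the relative interior of the current face, `z` extends from `L` to a functional
nonnegative on that face. Otherwise separation yields a matrix orthogonal to `L`, nonnegative on the
face and positive at an interior point (`extension_or_reduction`). A rotation turns its lower right
block into `diag(I_p, 0)` with `p > 0` without disturbing earlier members
(`exists_rotation_hasBlock`), and the search continues in the smaller face. A face of order at most
one never needs reduction, whence the bound `n - 1`. The outcome is `exists_regFR_certificate`.

For (D) infeasible and (P) not strongly infeasible, double orthogonality writes the members as
combinations of the data. Strict sequences are independent, so invertible row operations put them in
the leading positions. In the other two parts the members are dual variables, and rotating the data
by the inverse transpose suffices.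

Conversely, a regularized sequence is a facial reduction sequence, so its last member cannot be
negative on a semidefinite matrix orthogonal to the others (`IsRegFR.ip_last_nonneg`). This refutes
the property in question for the reformulated data, hence for the original data, because
`Step.isTransform` carries each property forward. -/

namespace SDPCert

open Matrix

/-! ### The trace inner product and its nondegeneracy -/

section InnerProduct

variable {n : ℕ}

lemma symMat_apply_comm (x : SymMat n) (i j : Fin n) :
    (x : Matrix (Fin n) (Fin n) ℝ) i j = (x : Matrix (Fin n) (Fin n) ℝ) j i :=
  Matrix.IsSymm.apply x.2 j i

lemma symMat_transpose_coe (x : SymMat n) :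
    (x : Matrix (Fin n) (Fin n) ℝ)ᵀ = x := x.2

lemma ip_eq_sum (x y : SymMat n) :
    ip x y = ∑ i, ∑ j, (x : Matrix (Fin n) (Fin n) ℝ) i j * (y : Matrix (Fin n) (Fin n) ℝ) i j := by
  simp only [ip, Matrix.trace, Matrix.diag_apply, Matrix.mul_apply]
  exact Finset.sum_congr rfl fun i _ => Finset.sum_congr rfl fun j _ => by rw [symMat_apply_comm y]

lemma ip_comm (x y : SymMat n) : ip x y = ip y x := Matrix.trace_mul_comm _ _

/-- The trace inner product as a bilinear map. -/
noncomputable def ipL (n : ℕ) : SymMat n →ₗ[ℝ] SymMat n →ₗ[ℝ] ℝ :=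
  LinearMap.mk₂ ℝ ip (by simp [ip, add_mul]) (by simp [ip]) (by simp [ip, mul_add]) (by simp [ip])

@[simp] lemma ipL_apply (x y : SymMat n) : ipL n x y = ip x y := rfl

lemma ip_add_left (x y z : SymMat n) : ip (x + y) z = ip x z + ip y z := 
  LinearMap.congr_fun ((ipL n).map_add x y) z

lemma ip_sub_left (x y z : SymMat n) : ip (x - y) z = ip x z - ip y z := 
  LinearMap.congr_fun ((ipL n).map_sub x y) z

lemma ip_smul_left (r : ℝ) (y z : SymMat n) : ip (r • y) z = r * ip y z := 
  LinearMap.congr_fun ((ipL n).map_smul r y) z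

lemma ip_add_right (z x y : SymMat n) : ip z (x + y) = ip z x + ip z y := (ipL n z).map_add x y

lemma ip_smul_right (r : ℝ) (z y : SymMat n) : ip z (r • y) = r * ip z y := (ipL n z).map_smul r y

lemma ip_zero_left (z : SymMat n) : ip 0 z = 0 := by simp [ip]

lemma ip_self_eq_zero {x : SymMat n} (h : ip x x = 0) : x = 0 := by
  rw [ip_eq_sum] at h
  ext i j
  have h1 := (Finset.sum_eq_zero_iff_of_nonneg
    (fun i _ => Finset.sum_nonneg fun j _ => mul_self_nonneg _)).1 h i (Finset.mem_univ _)
  have h2 := (Finset.sum_eq_zero_iff_of_nonneg (fun j _ => mul_self_nonneg _)).1 h1 j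
    (Finset.mem_univ _)
  simpa using h2

/-- Every linear functional is represented by the trace inner product. -/
lemma exists_ip_eq (φ : SymMat n →ₗ[ℝ] ℝ) : ∃ y : SymMat n, ∀ x, ip y x = φ x := by
  have hinj : Function.Injective (ipL n) := by
    rw [injective_iff_map_eq_zero]
    intro x hx
    exact ip_self_eq_zero (by simpa using LinearMap.congr_fun hx x)
  have hsurj : Function.Surjective (ipL n) :=
    (LinearMap.injective_iff_surjective_of_finrank_eq_finrank
      (Subspace.dual_finrank_eq (K := ℝ) (V := SymMat n)).symm).1 hinj
  obtain ⟨y, hy⟩ := hsurj φ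
  exact ⟨y, fun x => by rw [← hy]; rfl⟩

/-- A subspace of symmetric matrices equals its double orthogonal complement. -/
lemma mem_of_ip_eq_zero (R : Submodule ℝ (SymMat n)) (w : SymMat n)
    (h : ∀ y, (∀ r ∈ R, ip r y = 0) → ip w y = 0) : w ∈ R := by
  by_contra hw
  obtain ⟨f, hf, hR⟩ := R.exists_le_ker_of_notMem hw
  obtain ⟨y, hy⟩ := exists_ip_eq f
  refine hf ?_
  rw [← hy, ip_comm]
  refine h y fun r hr => ?_
  rw [ip_comm, hy]
  exact hR hr

end InnerProduct

/-! ### Self-duality of the semidefinite cone -/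

section PSD

variable {n : ℕ}

/-- The symmetric matrix `v * vᵀ`. -/
noncomputable def outer (v : Fin n → ℝ) : SymMat n :=
  ⟨vecMulVec v v, by simp [SymMat, Matrix.IsSymm, transpose_vecMulVec]⟩

lemma outer_mem_psd (v : Fin n → ℝ) : outer v ∈ psd n := by
  have := posSemidef_vecMulVec_self_star v
  simpa [psd, outer] using this

lemma ip_outer (y : SymMat n) (v : Fin n → ℝ) :
    ip y (outer v) = v ⬝ᵥ ((y : Matrix (Fin n) (Fin n) ℝ) *ᵥ v) := by
  simp only [ip_eq_sum, outer, vecMulVec_apply, dotProduct, mulVec, Finset.mul_sum]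
  exact Finset.sum_congr rfl fun i _ => Finset.sum_congr rfl fun j _ => by ring

lemma mem_psd_iff (x : SymMat n) :
    x ∈ psd n ↔ ∀ v, 0 ≤ v ⬝ᵥ ((x : Matrix (Fin n) (Fin n) ℝ) *ᵥ v) := by
  have hx : (x : Matrix (Fin n) (Fin n) ℝ).IsHermitian := by
    rw [Matrix.IsHermitian, conjTranspose_eq_transpose_of_trivial]; exact x.2
  change Matrix.PosSemidef _ ↔ _
  simp only [posSemidef_iff_dotProduct_mulVec, hx, true_and, star_trivial]

/-- Splitting `y` into matrices `v * vᵀ` reduces the pairing to values of the quadratic form of `x`.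
-/
lemma ip_nonneg {x y : SymMat n} (hx : x ∈ psd n) (hy : y ∈ psd n) : 0 ≤ ip x y := by
  obtain ⟨k, v, hv⟩ := Matrix.posSemidef_iff_eq_sum_vecMulVec.1 hy
  have hy' : y = ∑ i, outer (v i) := Subtype.ext (by simpa [outer] using hv)
  rw [hy', ← ipL_apply, map_sum]
  refine Finset.sum_nonneg fun i _ => ?_
  rw [ipL_apply, ip_outer]
  exact (mem_psd_iff x).1 hx _

/-- The positive semidefinite cone contains its dual. -/
lemma mem_psd_of_forall_ip_nonneg {y : SymMat n} (h : ∀ x ∈ psd n, 0 ≤ ip y x) : y ∈ psd n := by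
  rw [mem_psd_iff]
  intro v
  rw [← ip_outer]
  exact h _ (outer_mem_psd v)

lemma add_mem_psd {x y : SymMat n} (hx : x ∈ psd n) (hy : y ∈ psd n) : x + y ∈ psd n :=
  Matrix.PosSemidef.add hx hy

lemma smul_mem_psd {x : SymMat n} (hx : x ∈ psd n) {r : ℝ} (hr : 0 ≤ r) : r • x ∈ psd n :=
  Matrix.PosSemidef.smul hx hr

lemma zero_mem_psd : (0 : SymMat n) ∈ psd n := Matrix.PosSemidef.zero

end PSD

/-! ### Congruences and rotations -/

section Congruence

variable {n : ℕ}

/-- The linear map `x ↦ tᵀ * x * t`. -/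
noncomputable def congr (t : Matrix (Fin n) (Fin n) ℝ) : SymMat n →ₗ[ℝ] SymMat n where
  toFun x := ⟨tᵀ * (x : Matrix (Fin n) (Fin n) ℝ) * t, by
    change (_ : Matrix _ _ ℝ)ᵀ = _
    simp [Matrix.mul_assoc, symMat_transpose_coe x]⟩
  map_add' x y := by ext; simp [Matrix.mul_add, Matrix.add_mul]
  map_smul' r x := by ext; simp

lemma congr_coe (t : Matrix (Fin n) (Fin n) ℝ) (x : SymMat n) :
    (congr t x : Matrix (Fin n) (Fin n) ℝ) = tᵀ * (x : Matrix (Fin n) (Fin n) ℝ) * t := rfl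

lemma congr_congr (s t : Matrix (Fin n) (Fin n) ℝ) (x : SymMat n) :
    congr s (congr t x) = congr (t * s) x :=
  Subtype.ext (by simp [congr_coe, Matrix.mul_assoc])

lemma congr_one (x : SymMat n) : congr 1 x = x := Subtype.ext (by simp [congr_coe])

lemma ip_congr_left (t : Matrix (Fin n) (Fin n) ℝ) (x y : SymMat n) :
    ip (congr t x) y = ip x (congr tᵀ y) := by
  simp only [ip, congr_coe, transpose_transpose]
  rw [Matrix.mul_assoc, Matrix.mul_assoc, Matrix.trace_mul_comm]
  simp only [Matrix.mul_assoc]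

lemma congr_mem_psd (t : Matrix (Fin n) (Fin n) ℝ) {x : SymMat n} (hx : x ∈ psd n) :
    congr t x ∈ psd n := by
  have := Matrix.PosSemidef.conjTranspose_mul_mul_same hx t
  simpa [psd, congr_coe] using this

/-- The rotation `x ↦ tᵀ * x * t` given by an invertible matrix `t`. -/
noncomputable def rotation (t : (Matrix (Fin n) (Fin n) ℝ)ˣ) : SymMat n ≃ₗ[ℝ] SymMat n :=
  { congr (t : Matrix (Fin n) (Fin n) ℝ) with
    invFun := congr ((t⁻¹ : (Matrix (Fin n) (Fin n) ℝ)ˣ) : Matrix (Fin n) (Fin n) ℝ)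
    left_inv := fun x => by
      change congr _ (congr _ x) = x
      rw [congr_congr, Units.mul_inv, congr_one]
    right_inv := fun x => by
      change congr _ (congr _ x) = x
      rw [congr_congr, Units.inv_mul, congr_one] }

lemma rotation_apply (t : (Matrix (Fin n) (Fin n) ℝ)ˣ) (x : SymMat n) :
    rotation t x = congr (t : Matrix (Fin n) (Fin n) ℝ) x := rfl

lemma rotation_mem_rotations (t : (Matrix (Fin n) (Fin n) ℝ)ˣ) : rotation t ∈ rotations n :=
  ⟨t, t.isUnit, fun _ => rfl⟩

lemma rotations_subset_psdAut : rotations n ⊆ psdAut n := by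
  rintro T ⟨t, ht, hT⟩
  obtain ⟨u, rfl⟩ := ht
  have hTu : T = rotation u := LinearEquiv.ext fun x => Subtype.ext (hT x)
  subst hTu
  refine Set.Subset.antisymm ?_ fun x hx => ⟨(rotation u).symm x, congr_mem_psd _ hx, by simp⟩
  rintro _ ⟨x, hx, rfl⟩
  exact congr_mem_psd _ hx

end Congruence

/-! ### Block structure and supported matrices -/

section Block

variable {n : ℕ}

/-- The lower right block of `y` starting at the index `q` is the block diagonal matrix with
blocks an identity of order `p` and zero. -/
def HasBlock (q p : ℕ) (y : SymMat n) : Prop :=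
  ∀ r s : Fin n, q ≤ (r : ℕ) → q ≤ (s : ℕ) →
    (y : Matrix (Fin n) (Fin n) ℝ) r s = if r = s ∧ (r : ℕ) < q + p then 1 else 0

/-- The symmetric matrices supported on the lower right block starting at the index `q`. -/
def supported (n q : ℕ) : Submodule ℝ (SymMat n) where
  carrier := {x | ∀ r s : Fin n, (r : ℕ) < q → (x : Matrix (Fin n) (Fin n) ℝ) r s = 0}
  add_mem' hx hy r s hr := by simp [hx r s hr, hy r s hr]
  zero_mem' := by simp
  smul_mem' c x hx r s hr := by simp [hx r s hr]

lemma supported_zero (x : SymMat n) : x ∈ supported n 0 := fun _ _ h => absurd h (Nat.not_lt_zero _)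

lemma ip_of_hasBlock {q p : ℕ} {y x : SymMat n} (hy : HasBlock q p y) (hx : x ∈ supported n q) :
    ip y x = ∑ r : Fin n, if q ≤ (r : ℕ) ∧ (r : ℕ) < q + p then
      (x : Matrix (Fin n) (Fin n) ℝ) r r else 0 := by
  rw [ip_eq_sum]
  refine Finset.sum_congr rfl fun r _ => ?_
  rcases lt_or_ge (r : ℕ) q with hr | hr
  · rw [if_neg (by omega)]
    exact Finset.sum_eq_zero fun s _ => by rw [hx r s hr, mul_zero]
  · rw [Finset.sum_eq_single r]
    · rw [hy r r hr hr]
      simp [hr]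
    · intro s _ hs
      rcases lt_or_ge (s : ℕ) q with hsq | hsq
      · rw [symMat_apply_comm x, hx s r hsq, mul_zero]
      · rw [hy r s hr hsq, if_neg (fun h => hs h.1.symm), zero_mul]
    · simp

lemma apply_eq_zero_of_diag_eq_zero {x : SymMat n} (hx : x ∈ psd n) {r : Fin n}
    (hr : (x : Matrix (Fin n) (Fin n) ℝ) r r = 0) (s : Fin n) :
    (x : Matrix (Fin n) (Fin n) ℝ) r s = 0 := by
  obtain ⟨k, v, hv⟩ := Matrix.posSemidef_iff_eq_sum_vecMulVec.1 hx
  rw [hv] at hr ⊢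
  simp only [Matrix.sum_apply, vecMulVec_apply, star_trivial] at hr ⊢
  rw [Finset.sum_eq_zero_iff_of_nonneg (fun _ _ => mul_self_nonneg _)] at hr
  exact Finset.sum_eq_zero fun i hi => by rw [mul_self_eq_zero.1 (hr i hi), zero_mul]

lemma ip_nonneg_of_hasBlock {q p : ℕ} {y x : SymMat n} (hy : HasBlock q p y)
    (hxs : x ∈ supported n q) (hx : x ∈ psd n) : 0 ≤ ip y x := by
  rw [ip_of_hasBlock hy hxs]
  refine Finset.sum_nonneg fun r _ => ?_
  split_ifs
  exacts [Matrix.PosSemidef.diag_nonneg hx, le_rfl]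

/-- On the supported block the pairing is a sum of `p` diagonal entries of `x`, all nonnegative. If
it vanishes, each of them does, and a zero diagonal entry of a semidefinite matrix kills its whole
row. -/
lemma mem_supported_add {q p : ℕ} {y x : SymMat n} (hy : HasBlock q p y)
    (hxs : x ∈ supported n q) (hx : x ∈ psd n) (h : ip y x = 0) : x ∈ supported n (q + p) := by
  rw [ip_of_hasBlock hy hxs, Finset.sum_eq_zero_iff_of_nonneg] at h
  · intro r s hr
    rcases lt_or_ge (r : ℕ) q with hq | hq
    · exact hxs r s hq
    · have := h r (Finset.mem_univ _)
      rw [if_pos ⟨hq, hr⟩] at this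
      exact apply_eq_zero_of_diag_eq_zero hx this s
  · intro r _
    split_ifs
    exacts [Matrix.PosSemidef.diag_nonneg hx, le_rfl]

end Block

/-! ### Regularized and strict facial reduction sequences -/

section RegularSequence

variable {n k : ℕ}

lemma sum_Iio_val (P : ℕ → ℕ) (i : Fin k) :
    ∑ j ∈ Finset.Iio i, P j = ∑ j ∈ Finset.range i, P j := by
  have h : (Finset.Iio i).map Fin.valEmbedding = Finset.range (i : ℕ) := by
    rw [Fin.map_valEmbedding_Iio]; ext; simp
  rw [← h, Finset.sum_map]
  rfl

/-- Block sizes indexed by `ℕ` (zero beyond `k`) turn the offsets into sums over `Finset.range`,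
suited to induction and to appending a block. -/
lemma isRegFR_iff (y : Fin k → SymMat n) : IsRegFR y ↔
    ∃ P : ℕ → ℕ, ∑ i ∈ Finset.range k, P i ≤ n ∧
      ∀ i : Fin k, HasBlock (∑ j ∈ Finset.range i, P j) (P i) (y i) := by
  constructor
  · rintro ⟨p, hp, hy⟩
    obtain ⟨P, hP⟩ : ∃ P : ℕ → ℕ, p = fun i : Fin k => P i :=
      ⟨fun j => if h : j < k then p ⟨j, h⟩ else 0, by ext i; simp⟩
    subst hP
    refine ⟨P, by rwa [Finset.sum_range], fun i r s hr hs => ?_⟩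
    rw [← sum_Iio_val] at hr hs ⊢
    exact hy i r s hr hs
  · rintro ⟨P, hP, hy⟩
    refine ⟨fun i => P i, by rwa [Finset.sum_range] at hP, fun i r s hr hs => ?_⟩
    rw [sum_Iio_val] at hr hs ⊢
    exact hy i r s hr hs

lemma mem_supported_of_ip_eq_zero {P : ℕ → ℕ} {y : Fin k → SymMat n}
    (hy : ∀ i : Fin k, HasBlock (∑ j ∈ Finset.range i, P j) (P i) (y i)) {x : SymMat n}
    (hx : x ∈ psd n) : ∀ N : ℕ, N ≤ k → (∀ j : Fin k, (j : ℕ) < N → ip (y j) x = 0) →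
      x ∈ supported n (∑ j ∈ Finset.range N, P j) := by
  intro N
  induction N with
  | zero => intro _ _; exact supported_zero x
  | succ N ih =>
    intro hN h
    rw [Finset.sum_range_succ]
    exact mem_supported_add (hy ⟨N, hN⟩) (ih (by omega) fun j hj => h j (by omega)) hx
      (h ⟨N, hN⟩ (by simp))

lemma isFR_of_hasBlock {P : ℕ → ℕ} {y : Fin k → SymMat n}
    (hy : ∀ i : Fin k, HasBlock (∑ j ∈ Finset.range i, P j) (P i) (y i)) : IsFR (psd n) y :=
  fun i _ hx => ip_nonneg_of_hasBlock (hy i)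
    (mem_supported_of_ip_eq_zero hy hx.1 i i.2.le fun j hj => hx.2 j hj) hx.1

/-- A regularized facial reduction sequence is a facial reduction sequence. -/
lemma IsRegFR.isFR {y : Fin k → SymMat n} (hy : IsRegFR y) : IsFR (psd n) y := by
  obtain ⟨P, -, hy⟩ := (isRegFR_iff y).1 hy
  exact isFR_of_hasBlock hy

/-- The witness against orthogonality is the diagonal matrix unit at the first index of block `i`.
It pairs to `1` with `y i`, and to `0` with earlier members because their identity blocks end before
that index. -/
lemma isStrict_of_hasBlock {P : ℕ → ℕ} {y : Fin k → SymMat n}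
    (hPn : ∑ i ∈ Finset.range k, P i ≤ n) (hP : ∀ i < k, 0 < P i)
    (hy : ∀ i : Fin k, HasBlock (∑ j ∈ Finset.range i, P j) (P i) (y i)) :
    IsStrict (psd n) y := by
  refine fun i => ⟨isFR_of_hasBlock hy i, fun h => ?_⟩
  have hlt : ∑ j ∈ Finset.range i, P j < n := by
    refine lt_of_lt_of_le ?_ hPn
    refine lt_of_lt_of_le (Nat.lt_add_of_pos_right (hP i i.2)) ?_
    rw [← Finset.sum_range_succ]
    exact Finset.sum_le_sum_of_subset (Finset.range_mono i.2)
  have hip : ∀ z : SymMat n, ip z (outer (Pi.single (⟨_, hlt⟩ : Fin n) 1)) =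
      (z : Matrix (Fin n) (Fin n) ℝ) ⟨_, hlt⟩ ⟨_, hlt⟩ := by
    intro z
    rw [ip_outer]
    simp
  have h1 := h (outer (Pi.single ⟨_, hlt⟩ 1)) ⟨outer_mem_psd _, fun j hj => ?_⟩
  · rw [hip, hy i _ _ le_rfl le_rfl, if_pos ⟨rfl, Nat.lt_add_of_pos_right (hP i i.2)⟩] at h1
    exact one_ne_zero h1
  · have hle : ∑ l ∈ Finset.range j, P l + P j ≤ ∑ l ∈ Finset.range i, P l := by
      rw [← Finset.sum_range_succ]
      exact Finset.sum_le_sum_of_subset (Finset.range_mono hj)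
    rw [hip, hy j _ _ (by simp only; omega) (by simp only; omega), if_neg]
    simp only
    omega

/-- A strict facial reduction sequence is linearly independent. -/
lemma IsStrict.linearIndependent {K : Set (SymMat n)} {y : Fin k → SymMat n}
    (hy : IsStrict K y) : LinearIndependent ℝ y := by
  induction k with
  | zero => exact linearIndependent_empty_type
  | succ k ih =>
    rw [← Fin.snoc_init_self y, linearIndependent_finSnoc]
    have hcut : ∀ i : Fin k, cutBefore K (Fin.init y) i = cutBefore K y i.castSucc := by
      intro i
      ext x
      refine and_congr_right fun _ => ⟨fun h j hj => ?_, fun h j hj => h j.castSucc hj⟩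
      exact h ⟨j, lt_trans hj i.2⟩ hj
    refine ⟨ih fun i => ?_, fun hmem => (hy (Fin.last k)).2 fun x hx => ?_⟩
    · rw [hcut]
      exact hy i.castSucc
    -- If the last member were in the span of the earlier ones, it would be orthogonal to everything
    -- they are orthogonal to, against strictness.
    · have hle : Submodule.span ℝ (Set.range (Fin.init y)) ≤ LinearMap.ker ((ipL n).flip x) := by
        rw [Submodule.span_le]
        rintro _ ⟨i, rfl⟩
        exact hx.2 i.castSucc (Fin.castSucc_lt_last i)
      exact hle hmem

end RegularSequence

/-! ### Extension and separation for a cone with a relative interior point -/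

/-- Extension of a functional on a subspace that meets the interior of a convex cone relative to
the span of that cone. -/
lemma exists_nonneg_extension {V : Type*} [AddCommGroup V] [Module ℝ V] (s : PointedCone ℝ V)
    (U L : Submodule ℝ V) (hsU : ∀ x ∈ s, x ∈ U) {e X : V}
    (he : ∀ u ∈ U, ∃ c : ℝ, 0 ≤ c ∧ c • e + u ∈ s) (hX : X ∈ L) (hXe : X - e ∈ s)
    (z : V →ₗ[ℝ] ℝ) (hz : ∀ x ∈ L, x ∈ s → 0 ≤ z x) :
    ∃ h : V →ₗ[ℝ] ℝ, (∀ x ∈ L, h x = z x) ∧ ∀ x ∈ s, 0 ≤ h x := by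
  -- The Riesz extension theorem needs the domain and the cone to fill the space, so the domain is
  -- enlarged by `W`. This costs nothing: a cone element lies in `U`, so its `W`-component vanishes.
  obtain ⟨W, hW⟩ := (U ⊔ L).exists_isCompl
  suffices hs : ∃ g : V →ₗ[ℝ] ℝ, (∀ x : ↥(L ⊔ W), g x = z.domRestrict (L ⊔ W) x) ∧
      ∀ x ∈ s, 0 ≤ g x by
    obtain ⟨h, h1, h2⟩ := hs
    exact ⟨h, fun x hx => h1 ⟨x, Submodule.mem_sup_left hx⟩, h2⟩
  refine riesz_extension s ⟨L ⊔ W, z.domRestrict (L ⊔ W)⟩ ?_ ?_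
  · rintro ⟨x, hx⟩ hxs
    obtain ⟨l, hl, w, hw, rfl⟩ := Submodule.mem_sup.1 hx
    have hw0 : w = 0 := by
      refine (Submodule.disjoint_def.1 hW.disjoint) w ?_ hw
      have := (U ⊔ L).sub_mem (Submodule.mem_sup_left (hsU _ hxs)) (Submodule.mem_sup_right hl)
      simpa using this
    subst hw0
    simp only [add_zero] at hxs ⊢
    exact hz l hl hxs
  · intro y
    have hy : y ∈ (U ⊔ L) ⊔ W := by rw [hW.sup_eq_top]; trivial
    obtain ⟨ul, hul, w, hw, rfl⟩ := Submodule.mem_sup.1 hy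
    obtain ⟨u, hu, l, hl, rfl⟩ := Submodule.mem_sup.1 hul
    obtain ⟨c, hc, hcu⟩ := he u hu
    -- Adding `u + l + w` leaves `c • X + u = c • (X - e) + (c • e + u)`, a sum of two cone
    -- elements.
    refine ⟨⟨c • X - l - w, ?_⟩, ?_⟩
    · exact Submodule.sub_mem _ (Submodule.mem_sup_left (L.sub_mem (L.smul_mem c hX) hl))
        (Submodule.mem_sup_right hw)
    · have := s.add_mem (s.smul_mem hc hXe) hcu
      convert this using 1
      change _ = c • (X - e) + _
      simp only [smul_sub]
      abel

/-- If a subspace misses the interior of a convex cone relative to the span of that cone, then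
some functional vanishes on the subspace, and is nonnegative but nonzero on the cone. -/
lemma exists_separating_functional {V : Type*} [AddCommGroup V] [Module ℝ V]
    (s : PointedCone ℝ V) (U L : Submodule ℝ V) (hsU : ∀ x ∈ s, x ∈ U) {e : V} (hes : e ∈ s)
    (he : ∀ u ∈ U, ∃ c : ℝ, 0 ≤ c ∧ c • e + u ∈ s) (hL : ∀ X ∈ L, X - e ∉ s) :
    ∃ h : V →ₗ[ℝ] ℝ, (∀ x ∈ L, h x = 0) ∧ (∀ x ∈ s, 0 ≤ h x) ∧ 0 < h e := by
  have heL : e ∉ L := fun h => hL e h (by simp)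
  obtain ⟨f, hf, hfL⟩ := L.exists_le_ker_of_notMem heL
  set φ : V →ₗ[ℝ] ℝ := (f e)⁻¹ • f with hφ
  have hφe : φ e = 1 := by simp [hφ, hf]
  have hφL : ∀ x ∈ L, φ x = 0 := fun x hx => by
    have : f x = 0 := hfL hx
    simp [hφ, this]
  have heM : e ∈ L ⊔ ℝ ∙ e := Submodule.mem_sup_right (Submodule.mem_span_singleton_self e)
  -- The value at `l + t • e` is `t`. If `t < 0`, scaling by `(-t)⁻¹` puts `(-t)⁻¹ • l - e` in the
  -- cone, which `hL` excludes.
  have hnonneg : ∀ x ∈ L ⊔ ℝ ∙ e, x ∈ s → 0 ≤ φ x := by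
    intro x hx hxs
    obtain ⟨l, hl, te, hte, rfl⟩ := Submodule.mem_sup.1 hx
    obtain ⟨t, rfl⟩ := Submodule.mem_span_singleton.1 hte
    rw [map_add, map_smul, hφL l hl, hφe, zero_add, smul_eq_mul, mul_one]
    by_contra ht
    rw [not_le] at ht
    refine hL ((-t)⁻¹ • l) (L.smul_mem _ hl) ?_
    have := s.smul_mem (show (0 : ℝ) ≤ (-t)⁻¹ by rw [inv_nonneg]; linarith) hxs
    convert this using 1
    change _ = (-t)⁻¹ • (l + t • e)
    rw [smul_add, smul_smul, inv_neg, neg_mul, inv_mul_cancel₀ ht.ne, neg_smul, neg_smul, one_smul,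
      sub_eq_add_neg]
  obtain ⟨h, h1, h2⟩ := exists_nonneg_extension s U (L ⊔ ℝ ∙ e) hsU he
    (X := e + e) (Submodule.add_mem _ heM heM) (by simpa using hes) φ hnonneg
  exact ⟨h, fun x hx => by rw [h1 x (Submodule.mem_sup_left hx), hφL x hx], h2,
    by rw [h1 e heM, hφe]; exact one_pos⟩

/-! ### Faces given by a lower right block -/

section Face

variable {n : ℕ}

/-- The face of the positive semidefinite cone formed by the matrices supported on the lower right
block starting at the index `q`. -/
def face (n q : ℕ) : PointedCone ℝ (SymMat n) where
  carrier := {x | x ∈ psd n ∧ x ∈ supported n q}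
  add_mem' hx hy := ⟨add_mem_psd hx.1 hy.1, Submodule.add_mem _ hx.2 hy.2⟩
  zero_mem' := ⟨zero_mem_psd, Submodule.zero_mem _⟩
  smul_mem' c _ hx := ⟨smul_mem_psd hx.1 c.2, Submodule.smul_mem _ (c : ℝ) hx.2⟩

/-- The block diagonal matrix with blocks a zero matrix of order `q` and an identity. -/
noncomputable def faceUnit (n q : ℕ) : SymMat n :=
  ⟨Matrix.diagonal fun i : Fin n => if q ≤ (i : ℕ) then 1 else 0, Matrix.isSymm_diagonal _⟩

lemma faceUnit_coe (q : ℕ) : (faceUnit n q : Matrix (Fin n) (Fin n) ℝ) =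
    Matrix.diagonal fun i : Fin n => if q ≤ (i : ℕ) then 1 else 0 := rfl

lemma faceUnit_mem_face (q : ℕ) : faceUnit n q ∈ face n q := by
  refine ⟨Matrix.PosSemidef.diagonal fun i => ?_, fun r s hr => ?_⟩
  · change (0 : ℝ) ≤ if _ then _ else _
    split_ifs <;> norm_num
  · rw [faceUnit_coe, Matrix.diagonal_apply]
    split_ifs
    · omega
    · rfl
    · rfl

lemma faceUnit_mem_supported (q : ℕ) : faceUnit n q ∈ supported n q := (faceUnit_mem_face q).2

/-- Thus `faceUnit n q` is an order unit of the supported matrices and plays the part of a relative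
interior point. The sum of all `|M i j|` works as constant because `|v i * v j|` is at most the
squared norm of `v` over the coordinates from `q` on. -/
lemma exists_smul_faceUnit_add_mem (q : ℕ) (u : SymMat n) (hu : u ∈ supported n q) :
    ∃ c : ℝ, 0 ≤ c ∧ c • faceUnit n q + u ∈ face n q := by
  set M : Matrix (Fin n) (Fin n) ℝ := (u : Matrix (Fin n) (Fin n) ℝ) with hM
  refine ⟨∑ i, ∑ j, |M i j|, by positivity, ?_,
    Submodule.add_mem _ (Submodule.smul_mem _ _ (faceUnit_mem_supported q)) hu⟩
  rw [mem_psd_iff]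
  intro v
  set S : ℝ := ∑ i : Fin n, if q ≤ (i : ℕ) then v i * v i else 0 with hS
  have hS1 : ∀ i : Fin n, q ≤ (i : ℕ) → v i * v i ≤ S := fun i hi => by
    have := Finset.single_le_sum (f := fun i : Fin n => if q ≤ (i : ℕ) then v i * v i else 0)
      (fun j _ => by split_ifs; exacts [mul_self_nonneg _, le_rfl]) (Finset.mem_univ i)
    simpa [hi] using this
  have hE : ip (faceUnit n q) (outer v) = S := by
    rw [ip_eq_sum, hS]
    refine Finset.sum_congr rfl fun i _ => ?_
    rw [Finset.sum_eq_single i]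
    · simp [faceUnit_coe, outer, vecMulVec_apply]
    · intro j _ hj
      simp [faceUnit_coe, Matrix.diagonal_apply_ne' _ hj]
    · simp
  rw [← ip_outer, ip_add_left, ip_smul_left, hE, ip_eq_sum, Finset.sum_mul,
    ← Finset.sum_add_distrib]
  refine Finset.sum_nonneg fun i _ => ?_
  rw [Finset.sum_mul, ← Finset.sum_add_distrib]
  refine Finset.sum_nonneg fun j _ => ?_
  change 0 ≤ |M i j| * S + M i j * (v i * v j)
  rcases lt_or_ge (i : ℕ) q with hi | hi
  · have : M i j = 0 := hu i j hi
    simp [this]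
  rcases lt_or_ge (j : ℕ) q with hj | hj
  · have : M i j = 0 := by rw [hM, symMat_apply_comm]; exact hu j i hj
    simp [this]
  have h3 : |v i * v j| ≤ S := by
    rw [abs_le]
    constructor <;> nlinarith [hS1 i hi, hS1 j hj, sq_nonneg (v i + v j), sq_nonneg (v i - v j)]
  have h4 : -(|M i j| * S) ≤ M i j * (v i * v j) := by
    refine (neg_le_neg ?_).trans (neg_abs_le _)
    rw [abs_mul]
    exact mul_le_mul_of_nonneg_left h3 (abs_nonneg _)
  linarith

end Face

/-! ### Semidefinite matrices up to congruence -/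

section Diagonalization

lemma exists_sorted_congruence {r : ℕ} (D : Matrix (Fin r) (Fin r) ℝ) (hD : D.PosSemidef) :
    ∃ (t : Matrix (Fin r) (Fin r) ℝ) (p : ℕ), IsUnit t ∧ p ≤ r ∧
      tᵀ * D * t = Matrix.diagonal fun i : Fin r => if (i : ℕ) < p then 1 else 0 := by
  set lam := hD.isHermitian.eigenvalues with hlam
  have hpos : ∀ i, 0 ≤ lam i := hD.eigenvalues_nonneg
  set U : Matrix (Fin r) (Fin r) ℝ :=
    (hD.isHermitian.eigenvectorUnitary : Matrix (Fin r) (Fin r) ℝ) with hU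
  have hUU : Uᵀ * U = 1 := by
    have := Unitary.coe_star_mul_self hD.isHermitian.eigenvectorUnitary
    rwa [star_eq_conjTranspose, conjTranspose_eq_transpose_of_trivial] at this
  have hUD : Uᵀ * D * U = Matrix.diagonal lam := by
    have := hD.isHermitian.conjStarAlgAut_star_eigenvectorUnitary
    rw [Unitary.conjStarAlgAut_star_apply] at this
    rw [star_eq_conjTranspose, conjTranspose_eq_transpose_of_trivial] at this
    exact this
  -- Positive eigenvalues are rescaled to `1`; the factor `1` at zero eigenvalues keeps the scaling
  -- invertible.
  set μ : Fin r → ℝ := fun i => if lam i = 0 then 1 else (Real.sqrt (lam i))⁻¹ with hμ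
  have hμ0 : ∀ i, μ i ≠ 0 := fun i => by
    simp only [hμ]
    split_ifs with h
    · exact one_ne_zero
    · exact inv_ne_zero (Real.sqrt_ne_zero'.2 (lt_of_le_of_ne (hpos i) (Ne.symm h)))
  -- Sorting by this key places the nonzero eigenvalues first; `p` below is their number.
  set f : Fin r → ℕ := fun i => if lam i = 0 then 1 else 0 with hf
  set σ := Tuple.sort f with hσ
  have hmono : Monotone (f ∘ σ) := Tuple.monotone_sort f
  obtain ⟨p, hpr, hp⟩ : ∃ p ≤ r, ∀ i : Fin r, f (σ i) = 0 ↔ (i : ℕ) < p := by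
    by_cases hex : ∃ i : Fin r, f (σ i) ≠ 0
    · have hex' : ∃ N : ℕ, ∃ h : N < r, f (σ ⟨N, h⟩) ≠ 0 := by
        obtain ⟨i, hi⟩ := hex
        exact ⟨i, i.2, hi⟩
      classical
      obtain ⟨hlt, hne⟩ := Nat.find_spec hex'
      refine ⟨Nat.find hex', hlt.le, fun i => ⟨fun h => ?_, fun h => ?_⟩⟩
      · by_contra hi
        rw [not_lt] at hi
        have := hmono (show (⟨Nat.find hex', hlt⟩ : Fin r) ≤ i from hi)
        simp only [Function.comp] at this
        omega
      · by_contra hi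
        exact Nat.find_min hex' h ⟨i.2, hi⟩
    · push Not at hex
      exact ⟨r, le_rfl, fun i => ⟨fun _ => i.2, fun _ => hex i⟩⟩
  have hunit : IsUnit (U * Matrix.diagonal μ) := by
    refine IsUnit.mul (IsUnit.of_mul_eq_one_right _ hUU) ?_
    rw [Matrix.isUnit_diagonal, Pi.isUnit_iff]
    exact fun i => (hμ0 i).isUnit
  refine ⟨(U * Matrix.diagonal μ).submatrix (Equiv.refl _) σ, p, ?_, hpr, ?_⟩
  · rw [Matrix.isUnit_submatrix_equiv]
    exact hunit
  · have h1 : (U * Matrix.diagonal μ)ᵀ * D * (U * Matrix.diagonal μ) =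
        Matrix.diagonal fun i => if f i = 0 then 1 else 0 := by
      rw [transpose_mul, diagonal_transpose]
      calc Matrix.diagonal μ * Uᵀ * D * (U * Matrix.diagonal μ)
          = Matrix.diagonal μ * (Uᵀ * D * U) * Matrix.diagonal μ := by
            simp only [Matrix.mul_assoc]
        _ = _ := by
            rw [hUD, diagonal_mul_diagonal, diagonal_mul_diagonal]
            congr 1
            ext i
            by_cases h : lam i = 0
            · simp [hμ, hf, h]
            · have h1 := Real.sq_sqrt (hpos i)
              have h0 := Real.sqrt_ne_zero'.2 (lt_of_le_of_ne (hpos i) (Ne.symm h))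
              simp only [hμ, hf, h, if_false, if_true]
              field_simp
              exact h1.symm
    have h2 : ((U * Matrix.diagonal μ).submatrix (Equiv.refl _) σ)ᵀ * D *
        (U * Matrix.diagonal μ).submatrix (Equiv.refl _) σ =
        ((U * Matrix.diagonal μ)ᵀ * D * (U * Matrix.diagonal μ)).submatrix σ σ := by
      ext i j
      simp [Matrix.mul_apply]
    rw [h2, h1, Matrix.submatrix_diagonal_equiv]
    congr 1
    ext i
    simp only [Function.comp, hp]

end Diagonalization

/-! ### Rotations acting on the lower right block -/

section BlockRotation

/-- The block diagonal matrix with blocks an identity of order `q` and `t`. -/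
def blockExtend (q : ℕ) {r : ℕ} (t : Matrix (Fin r) (Fin r) ℝ) :
    Matrix (Fin (q + r)) (Fin (q + r)) ℝ :=
  (fromBlocks 1 0 0 t).submatrix finSumFinEquiv.symm finSumFinEquiv.symm

lemma isUnit_blockExtend (q : ℕ) {r : ℕ} {t : Matrix (Fin r) (Fin r) ℝ} (ht : IsUnit t) :
    IsUnit (blockExtend q t) := by
  rw [blockExtend, Matrix.isUnit_submatrix_equiv, Matrix.isUnit_iff_isUnit_det,
    Matrix.det_fromBlocks_zero₂₁, det_one, one_mul, ← Matrix.isUnit_iff_isUnit_det]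
  exact ht

lemma congr_blockExtend {q r : ℕ} (t : Matrix (Fin r) (Fin r) ℝ) (y : SymMat (q + r)) :
    (congr (blockExtend q t) y : Matrix (Fin (q + r)) (Fin (q + r)) ℝ) =
      (fromBlocks
        ((y : Matrix (Fin (q + r)) (Fin (q + r)) ℝ).submatrix (Fin.castAdd r) (Fin.castAdd r))
        ((y : Matrix (Fin (q + r)) (Fin (q + r)) ℝ).submatrix (Fin.castAdd r) (Fin.natAdd q) * t)
        (tᵀ * (y : Matrix (Fin (q + r)) (Fin (q + r)) ℝ).submatrix (Fin.natAdd q) (Fin.castAdd r))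
        (tᵀ * (y : Matrix (Fin (q + r)) (Fin (q + r)) ℝ).submatrix (Fin.natAdd q) (Fin.natAdd q)
          * t)).submatrix finSumFinEquiv.symm finSumFinEquiv.symm := by
  set M : Matrix (Fin (q + r)) (Fin (q + r)) ℝ := (y : Matrix (Fin (q + r)) (Fin (q + r)) ℝ)
  have hM : M = (fromBlocks (M.submatrix (Fin.castAdd r) (Fin.castAdd r))
      (M.submatrix (Fin.castAdd r) (Fin.natAdd q)) (M.submatrix (Fin.natAdd q) (Fin.castAdd r))
      (M.submatrix (Fin.natAdd q) (Fin.natAdd q))).submatrix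
        finSumFinEquiv.symm finSumFinEquiv.symm := by
    ext i j
    refine Fin.addCases (fun i => ?_) (fun i => ?_) i <;>
    refine Fin.addCases (fun j => ?_) (fun j => ?_) j <;> simp
  rw [congr_coe]
  change (blockExtend q t)ᵀ * M * _ = _
  conv_lhs => rw [hM]
  rw [blockExtend, transpose_submatrix, submatrix_mul_equiv, submatrix_mul_equiv,
    fromBlocks_transpose, fromBlocks_multiply, fromBlocks_multiply]
  simp

/-- Only indices from `q` on are mixed, and the identity block ends by `q`. Within the prescribed
block of `y` those rows and columns are zero, so mixing them changes nothing there. -/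
lemma hasBlock_congr_blockExtend {q r q₀ p₀ : ℕ} (t : Matrix (Fin r) (Fin r) ℝ)
    {y : SymMat (q + r)} (h : q₀ + p₀ ≤ q) (hy : HasBlock q₀ p₀ y) :
    HasBlock q₀ p₀ (congr (blockExtend q t) y) := by
  have hD : (y : Matrix (Fin (q + r)) (Fin (q + r)) ℝ).submatrix (Fin.natAdd q) (Fin.natAdd q)
      = 0 := by
    ext i j
    rw [submatrix_apply, hy _ _ (by simp; omega) (by simp; omega), if_neg (by simp; omega)]
    rfl
  intro i j
  rw [congr_blockExtend, hD]
  refine Fin.addCases (fun i => ?_) (fun i => ?_) i <;>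
  refine Fin.addCases (fun j => ?_) (fun j => ?_) j <;> intro hi hj
  · simpa using hy _ _ hi hj
  · have hrow : ∀ l, (y : Matrix (Fin (q + r)) (Fin (q + r)) ℝ) (Fin.castAdd r i)
        (Fin.natAdd q l) = 0 := fun l => by
      rw [hy _ _ hi (by simp; omega), if_neg]
      rintro ⟨h1, -⟩
      have := congrArg Fin.val h1
      simp at this
      omega
    rw [if_neg]
    · simp [Matrix.mul_apply, hrow]
    · rintro ⟨h1, -⟩
      have := congrArg Fin.val h1
      simp at this
      omega
  · have hcol : ∀ l, (y : Matrix (Fin (q + r)) (Fin (q + r)) ℝ) (Fin.natAdd q l)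
        (Fin.castAdd r j) = 0 := fun l => by
      rw [hy _ _ (by simp; omega) hj, if_neg]
      rintro ⟨h1, -⟩
      have := congrArg Fin.val h1
      simp at this
      omega
    rw [if_neg]
    · simp [Matrix.mul_apply, hcol]
    · rintro ⟨h1, -⟩
      have := congrArg Fin.val h1
      simp at this
      omega
  · rw [if_neg (by simp; omega)]
    simp

lemma ip_faceUnit {n : ℕ} (q : ℕ) (y : SymMat n) : ip y (faceUnit n q) =
    ∑ i : Fin n, if q ≤ (i : ℕ) then (y : Matrix (Fin n) (Fin n) ℝ) i i else 0 := by
  rw [ip_eq_sum]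
  refine Finset.sum_congr rfl fun i _ => ?_
  rw [Finset.sum_eq_single i]
  · simp [faceUnit_coe]
  · intro j _ hj
    simp [faceUnit_coe, Matrix.diagonal_apply_ne' _ hj]
  · simp

/-- Padding `v` with zeros gives a matrix `v * vᵀ` in the face, and pairing with it evaluates the
quadratic form of the block. -/
lemma posSemidef_lowerBlock {q r : ℕ} {y : SymMat (q + r)}
    (hy : ∀ x ∈ face (q + r) q, 0 ≤ ip y x) :
    ((y : Matrix (Fin (q + r)) (Fin (q + r)) ℝ).submatrix (Fin.natAdd q)
      (Fin.natAdd q)).PosSemidef := by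
  refine Matrix.PosSemidef.of_dotProduct_mulVec_nonneg ?_ fun v => ?_
  · rw [Matrix.IsHermitian, conjTranspose_eq_transpose_of_trivial, transpose_submatrix,
      symMat_transpose_coe]
  · have h := hy (outer (Fin.addCases (fun _ => 0) v)) ⟨outer_mem_psd _, fun i j hi => ?_⟩
    · rw [ip_outer] at h
      simpa [dotProduct, mulVec, Fin.sum_univ_add] using h
    · obtain ⟨i, rfl⟩ : ∃ i' : Fin q, i = Fin.castAdd r i' := ⟨⟨i, hi⟩, rfl⟩
      simp [outer, vecMulVec_apply]

/-- A matrix in the dual of a face can be brought to block diagonal form by a rotation that keeps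
the block structure of the earlier members of a regularized sequence. -/
lemma exists_rotation_hasBlock {n q : ℕ} (hq : q ≤ n) (y : SymMat n)
    (hy : ∀ x ∈ face n q, 0 ≤ ip y x) :
    ∃ (t : (Matrix (Fin n) (Fin n) ℝ)ˣ) (p : ℕ), q + p ≤ n ∧
      HasBlock q p (congr (t : Matrix (Fin n) (Fin n) ℝ) y) ∧
      (∀ q₀ p₀ y₀, q₀ + p₀ ≤ q → HasBlock q₀ p₀ y₀ →
        HasBlock q₀ p₀ (congr (t : Matrix (Fin n) (Fin n) ℝ) y₀)) ∧
      (0 < ip y (faceUnit n q) → 0 < p) := by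
  obtain ⟨r, rfl⟩ := Nat.exists_eq_add_of_le hq
  obtain ⟨t, p, ht, hp, hD⟩ := exists_sorted_congruence _ (posSemidef_lowerBlock hy)
  obtain ⟨u, hu⟩ := isUnit_blockExtend q ht
  refine ⟨u, p, by omega, ?_, fun q₀ p₀ y₀ h h₀ => ?_, fun hpos => ?_⟩
  · intro i j hi hj
    rw [hu, congr_blockExtend, hD]
    obtain ⟨i, rfl⟩ : ∃ i' : Fin r, i = Fin.natAdd q i' :=
      ⟨⟨i - q, by omega⟩, Fin.ext (by simp; omega)⟩
    obtain ⟨j, rfl⟩ : ∃ j' : Fin r, j = Fin.natAdd q j' :=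
      ⟨⟨j - q, by omega⟩, Fin.ext (by simp; omega)⟩
    simp [Matrix.diagonal_apply, ite_and]
  · rw [hu]
    exact hasBlock_congr_blockExtend t h h₀
  -- If `p = 0`, the block is congruent to zero, hence zero, and its trace `ip y (faceUnit _ q)`
  -- vanishes.
  · by_contra hp0
    obtain rfl : p = 0 := by omega
    simp only [not_lt_zero, if_false, Matrix.diagonal_zero] at hD
    have htt : IsUnit tᵀ := (Matrix.isUnit_transpose t).2 ht
    have hD0 := htt.mul_right_eq_zero.1 (ht.mul_left_eq_zero.1 hD)
    refine hpos.ne' ?_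
    rw [ip_faceUnit, Fin.sum_univ_add]
    have hdiag : ∀ i, (y : Matrix (Fin (q + r)) (Fin (q + r)) ℝ) (Fin.natAdd q i)
        (Fin.natAdd q i) = 0 := fun i => congrFun (congrFun hD0 i) i
    have hlt : ∀ i : Fin q, ¬ q ≤ (i : ℕ) := fun i => not_le.2 i.2
    simp [hdiag, hlt]

end BlockRotation

/-! ### Facial reduction -/

section Certificate

variable {n : ℕ}

lemma eq_smul_faceUnit {q : ℕ} (hq : n ≤ q + 1) {x : SymMat n} (hx : x ∈ supported n q) :
    x = ip x (faceUnit n q) • faceUnit n q := by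
  ext r s
  simp only [Submodule.coe_smul, Matrix.smul_apply, smul_eq_mul, faceUnit_coe]
  rcases lt_or_ge (r : ℕ) q with hr | hr
  · rw [hx r s hr, Matrix.diagonal_apply, if_neg (not_le.2 hr), ite_self, mul_zero]
  rcases lt_or_ge (s : ℕ) q with hs | hs
  · rw [symMat_apply_comm x, hx s r hs, Matrix.diagonal_apply_ne _ (fun h => by
      rw [h] at hr; omega), mul_zero]
  obtain rfl : r = s := Fin.ext (by omega)
  rw [Matrix.diagonal_apply_eq, if_pos hr, mul_one, ip_faceUnit, Finset.sum_eq_single r]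
  · rw [if_pos hr]
  · intro i _ hi
    rw [if_neg]
    exact fun h => hi (Fin.ext (by omega))
  · simp

/-- Either a functional that is nonnegative on the part of a face in a subspace extends to one
that is nonnegative on the face, or the face can be reduced. -/
lemma extension_or_reduction (q : ℕ) (L : Submodule ℝ (SymMat n)) (z : SymMat n →ₗ[ℝ] ℝ)
    (hz : ∀ x ∈ L, x ∈ psd n → 0 ≤ z x) :
    (∃ h : SymMat n, (∀ x ∈ L, ip h x = z x) ∧ ∀ x ∈ face n q, 0 ≤ ip h x) ∨
      (q + 2 ≤ n ∧ ∃ h : SymMat n, (∀ x ∈ L, ip h x = 0) ∧ (∀ x ∈ face n q, 0 ≤ ip h x) ∧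
        0 < ip h (faceUnit n q)) := by
  -- A Slater condition: up to scaling, `L` meets the relative interior of the face.
  by_cases hS : ∃ X ∈ L, X - faceUnit n q ∈ face n q
  · obtain ⟨X, hX, hXe⟩ := hS
    obtain ⟨f, hf1, hf2⟩ := exists_nonneg_extension (face n q) (supported n q) L
      (fun x hx => hx.2) (exists_smul_faceUnit_add_mem q) hX hXe z (fun x hx hxs => hz x hx hxs.1)
    obtain ⟨h, hh⟩ := exists_ip_eq f
    exact Or.inl ⟨h, fun x hx => by rw [hh, hf1 x hx], fun x hx => by rw [hh]; exact hf2 x hx⟩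
  rcases le_or_gt (q + 2) n with hq | hq
  · push Not at hS
    obtain ⟨f, hf1, hf2, hf3⟩ := exists_separating_functional (face n q) (supported n q) L
      (fun x hx => hx.2) (faceUnit_mem_face q) (exists_smul_faceUnit_add_mem q) hS
    obtain ⟨h, hh⟩ := exists_ip_eq f
    refine Or.inr ⟨hq, h, fun x hx => by rw [hh, hf1 x hx], fun x hx => by rw [hh]; exact hf2 x hx,
      by rw [hh]; exact hf3⟩
  -- Here the face is a ray or zero. Subtracting a multiple of a functional that kills `L` makes the
  -- value at its generator zero, so no reduction is spent on this face.
  · left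
    obtain ⟨f, hf1, hf2⟩ : ∃ f : SymMat n →ₗ[ℝ] ℝ, (∀ x ∈ L, f x = z x) ∧
        0 ≤ f (faceUnit n q) := by
      by_cases he : faceUnit n q ∈ L
      · exact ⟨z, fun _ _ => rfl, hz _ he (faceUnit_mem_face q).1⟩
      · obtain ⟨g, hg, hgL⟩ := L.exists_le_ker_of_notMem he
        refine ⟨z - (z (faceUnit n q) / g (faceUnit n q)) • g, fun x hx => ?_, ?_⟩
        · have : g x = 0 := hgL hx
          simp [this]
        · simp [hg]
    obtain ⟨h, hh⟩ := exists_ip_eq f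
    refine ⟨h, fun x hx => by rw [hh, hf1 x hx], fun x hx => ?_⟩
    rw [hh, eq_smul_faceUnit (by omega) hx.2, map_smul, smul_eq_mul]
    exact mul_nonneg (ip_nonneg hx.1 (faceUnit_mem_face q).1) hf2

/-- The first `k` members of `w` annihilate the subspace `L`, and after the rotation by `t` they
form a regularized facial reduction sequence with positive block sizes `p`. -/
def IsReducing (L : Submodule ℝ (SymMat n)) (t : (Matrix (Fin n) (Fin n) ℝ)ˣ) (k : ℕ)
    (w : ℕ → SymMat n) (p : ℕ → ℕ) : Prop :=
  ∀ i < k, HasBlock (∑ j ∈ Finset.range i, p j) (p i)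
    (congr (t : Matrix (Fin n) (Fin n) ℝ) (w i)) ∧ 0 < p i ∧ ∀ x ∈ L, ip (w i) x = 0

lemma sum_range_update (p : ℕ → ℕ) (k a : ℕ) {i : ℕ} (hi : i ≤ k) :
    ∑ j ∈ Finset.range i, Function.update p k a j = ∑ j ∈ Finset.range i, p j :=
  Finset.sum_congr rfl fun _ hj => Function.update_of_ne
    (ne_of_lt (lt_of_lt_of_le (Finset.mem_range.1 hj) hi)) _ _

lemma IsReducing.update {L : Submodule ℝ (SymMat n)} {t s : (Matrix (Fin n) (Fin n) ℝ)ˣ} {k : ℕ}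
    {w : ℕ → SymMat n} {p : ℕ → ℕ} (hw : IsReducing L t k w p)
    (hs : ∀ q₀ p₀ y₀, q₀ + p₀ ≤ ∑ j ∈ Finset.range k, p j → HasBlock q₀ p₀ y₀ →
        HasBlock q₀ p₀ (congr (s : Matrix (Fin n) (Fin n) ℝ) y₀)) (v : SymMat n) (a : ℕ) :
    IsReducing L (t * s) k (Function.update w k v) (Function.update p k a) := by
  intro i hi
  obtain ⟨h1, h2, h3⟩ := hw i hi
  rw [sum_range_update p k a hi.le, Function.update_of_ne hi.ne, Function.update_of_ne hi.ne]
  refine ⟨?_, h2, h3⟩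
  rw [Units.val_mul, ← congr_congr]
  refine hs _ _ _ ?_ h1
  rw [← Finset.sum_range_succ]
  exact Finset.sum_le_sum_of_subset (Finset.range_mono hi)

/-- Induction on the order `d` of the remaining face, which drops because every new block is
nonempty. Since `k` is at most the total block size `q` and a reduction occurs only if `q + 2 ≤ n`,
the bound `k + 1 ≤ n` survives each reduction. -/
lemma exists_reducing_extension (L : Submodule ℝ (SymMat n)) (z : SymMat n →ₗ[ℝ] ℝ)
    (hz : ∀ x ∈ L, x ∈ psd n → 0 ≤ z x) (d : ℕ) :
    ∀ (k : ℕ) (t : (Matrix (Fin n) (Fin n) ℝ)ˣ) (w : ℕ → SymMat n) (p : ℕ → ℕ),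
      IsReducing L t k w p → n - ∑ j ∈ Finset.range k, p j = d →
      ∑ j ∈ Finset.range k, p j ≤ n → k ≤ ∑ j ∈ Finset.range k, p j → k + 1 ≤ n →
      ∃ (k : ℕ) (t : (Matrix (Fin n) (Fin n) ℝ)ˣ) (w : ℕ → SymMat n) (p : ℕ → ℕ),
        IsReducing L t k w p ∧ k + 1 ≤ n ∧ ∑ j ∈ Finset.range (k + 1), p j ≤ n ∧
          HasBlock (∑ j ∈ Finset.range k, p j) (p k)
            (congr (t : Matrix (Fin n) (Fin n) ℝ) (w k)) ∧ ∀ x ∈ L, ip (w k) x = z x := by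
  induction d using Nat.strong_induction_on with
  | _ d ih =>
  intro k t w p hw hd hpn hkp hkn
  set T : Matrix (Fin n) (Fin n) ℝ := (t : Matrix (Fin n) (Fin n) ℝ) with hT
  set T' : Matrix (Fin n) (Fin n) ℝ :=
    ((t⁻¹ : (Matrix (Fin n) (Fin n) ℝ)ˣ) : Matrix (Fin n) (Fin n) ℝ) with hT'
  have hTT : T' * T = 1 := t.inv_mul
  have hinv : ∀ x : SymMat n, congr Tᵀ (congr T'ᵀ x) = x := fun x => by
    rw [congr_congr, ← transpose_mul, show T * T' = 1 from t.mul_inv, transpose_one, congr_one]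
  have hinv' : ∀ x : SymMat n, congr T (congr T' x) = x := fun x => by
    rw [congr_congr, hTT, congr_one]
  have hblock : ∀ (s : (Matrix (Fin n) (Fin n) ℝ)ˣ) (h : SymMat n),
      congr ((t * s : (Matrix (Fin n) (Fin n) ℝ)ˣ) : Matrix (Fin n) (Fin n) ℝ) (congr T' h) =
        congr (s : Matrix (Fin n) (Fin n) ℝ) h := fun s h => by
    rw [Units.val_mul, ← congr_congr, hinv']
  -- Pairing a rotated matrix with `x` is pairing the original with `congr Tᵀ x`, so in rotated
  -- coordinates `L` and `z` are replaced by their pullbacks along `congr Tᵀ`.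
  rcases extension_or_reduction (∑ j ∈ Finset.range k, p j) (L.comap (congr Tᵀ))
    (z.comp (congr Tᵀ)) (fun x hx hxp => hz _ hx (congr_mem_psd _ hxp)) with
    ⟨h, hL, hF⟩ | ⟨hq2, h, hL, hF, he⟩
  · obtain ⟨s, a, ha, hB, hs, -⟩ := exists_rotation_hasBlock hpn h hF
    -- The new member is stored in the original coordinates, as `congr T' h`; rotation by `t * s`
    -- sends it to `congr s h`.
    refine ⟨k, t * s, _, _, hw.update hs (congr T' h) a, hkn, ?_, ?_, fun x hx => ?_⟩
    · rw [Finset.sum_range_succ, sum_range_update p k a le_rfl, Function.update_self]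
      exact ha
    · rw [sum_range_update p k a le_rfl, Function.update_self, Function.update_self, hblock]
      exact hB
    · rw [Function.update_self, ip_congr_left, hL]
      · rw [LinearMap.comp_apply, hinv]
      · rw [Submodule.mem_comap, hinv]
        exact hx
  · obtain ⟨s, a, ha, hB, hs, hpos⟩ := exists_rotation_hasBlock hpn h hF
    have ha0 := hpos he
    have hsum : ∑ j ∈ Finset.range (k + 1), Function.update p k a j =
        ∑ j ∈ Finset.range k, p j + a := by
      rw [Finset.sum_range_succ, sum_range_update p k a le_rfl, Function.update_self]
    refine ih (n - (∑ j ∈ Finset.range k, p j + a)) (by omega) (k + 1) (t * s)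
      (Function.update w k (congr T' h)) (Function.update p k a) ?_ (by rw [hsum])
      (by rw [hsum]; exact ha) (by rw [hsum]; omega) (by omega)
    intro i hi
    rcases Nat.lt_succ_iff_lt_or_eq.1 hi with hik | rfl
    · exact hw.update hs _ a i hik
    · rw [sum_range_update p i a le_rfl, Function.update_self, Function.update_self, hblock]
      refine ⟨hB, ha0, fun x hx => ?_⟩
      rw [ip_congr_left, hL]
      rw [Submodule.mem_comap, hinv]
      exact hx

/-- A functional that is nonnegative on the positive semidefinite matrices of a subspace is
represented on that subspace by the last member of a pre-strict facial reduction sequence whose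
other members annihilate the subspace; some rotation brings this sequence to regularized form. -/
theorem exists_regFR_certificate (hn : 1 ≤ n) (L : Submodule ℝ (SymMat n))
    (z : SymMat n →ₗ[ℝ] ℝ) (hz : ∀ x ∈ L, x ∈ psd n → 0 ≤ z x) :
    ∃ (t : (Matrix (Fin n) (Fin n) ℝ)ˣ) (k : ℕ) (w : Fin (k + 1) → SymMat n), k ≤ n - 1 ∧
      IsRegFR (fun i => rotation t (w i)) ∧ IsPreStrict (psd n) (fun i => rotation t (w i)) ∧
      LinearIndependent ℝ (fun i : Fin k => w i.castSucc) ∧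
      (∀ i : Fin k, ∀ x ∈ L, ip (w i.castSucc) x = 0) ∧ ∀ x ∈ L, ip (w (Fin.last k)) x = z x := by
  obtain ⟨k, t, w, p, hw, hkn, hpn, hB, hL⟩ := exists_reducing_extension L z hz n 0 1 0 0
    (fun i hi => absurd hi (Nat.not_lt_zero i)) (by simp) (by simp) (by simp) (by omega)
  have hreg : IsRegFR (fun i : Fin (k + 1) => rotation t (w i)) := by
    refine (isRegFR_iff _).2 ⟨p, hpn, fun i => ?_⟩
    rcases Nat.lt_succ_iff_lt_or_eq.1 i.2 with hik | hik
    · exact (hw i hik).1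
    · rw [hik]
      exact hB
  have hstrict : IsStrict (psd n) (fun i : Fin k => rotation t (w i)) := by
    refine isStrict_of_hasBlock (P := p) ?_ (fun i hi => (hw i hi).2.1) fun i => (hw i i.2).1
    rw [Finset.sum_range_succ] at hpn
    omega
  refine ⟨t, k, fun i => w i, by omega, hreg, ⟨hreg.isFR, hstrict⟩, ?_,
    fun i => (hw i i.2).2.2, hL⟩
  exact LinearIndependent.of_comp (rotation t).toLinearMap hstrict.linearIndependent

end Certificate

/-! ### Row operations on the data -/

namespace SDPData

variable {m n : ℕ}

/-- The operator of the primal problem as a linear map. -/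
noncomputable def opL (P : SDPData m n) : (Fin m → ℝ) →ₗ[ℝ] SymMat n :=
  Fintype.linearCombination ℝ P.a

@[simp] lemma opL_apply (P : SDPData m n) (x : Fin m → ℝ) : P.opL x = P.op x := rfl

/-- The objective function of the primal problem as a linear map. -/
noncomputable def obj (P : SDPData m n) : (Fin m → ℝ) →ₗ[ℝ] ℝ :=
  Fintype.linearCombination ℝ P.c

lemma obj_apply (P : SDPData m n) (x : Fin m → ℝ) : P.obj x = ∑ i, P.c i * x i := by
  simp [obj, Fintype.linearCombination_apply, mul_comm]

lemma op_single (P : SDPData m n) (i : Fin m) : P.op (Pi.single i 1) = P.a i := by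
  simp [op, Pi.single_apply, ite_smul]

lemma obj_single (P : SDPData m n) (i : Fin m) : P.obj (Pi.single i 1) = P.c i := by
  rw [obj, Fintype.linearCombination_apply_single]
  simp

lemma ip_op (P : SDPData m n) (x : Fin m → ℝ) (y : SymMat n) :
    ip (P.op x) y = ∑ i, x i * P.adj y i := by
  have : ip (P.op x) y = (ipL n).flip y (∑ i, x i • P.a i) := rfl
  rw [this, map_sum]
  simp [adj]

/-- A matrix is feasible for the equality constraints of the dual exactly when it represents the
objective function of the primal. -/
lemma adj_eq_iff (P : SDPData m n) (y : SymMat n) (c : Fin m → ℝ) :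
    P.adj y = c ↔ ∀ x, ip (P.op x) y = ∑ i, c i * x i := by
  constructor
  · rintro rfl x
    rw [ip_op]
    exact Finset.sum_congr rfl fun i _ => mul_comm _ _
  · intro h
    ext i
    have := h (Pi.single i 1)
    rw [op_single] at this
    rw [adj, this, Finset.sum_eq_single i (fun j _ hj => by simp [hj]) (by simp)]
    simp

lemma adj_eq_c_iff (P : SDPData m n) (y : SymMat n) :
    P.adj y = P.c ↔ ∀ x, ip (P.op x) y = P.obj x := by
  simp only [adj_eq_iff, obj_apply]

lemma adj_eq_zero_iff (P : SDPData m n) (y : SymMat n) :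
    P.adj y = 0 ↔ ∀ x, ip (P.op x) y = 0 := by
  simp [adj_eq_iff]

/-- The data obtained by replacing the rows of the system by their combinations with coefficients
the rows of a matrix. -/
noncomputable def rowOp (P : SDPData m n) (M : Matrix (Fin m) (Fin m) ℝ) : SDPData m n :=
  ⟨fun i => P.op (M i), P.b, fun i => P.obj (M i)⟩

/-- The data obtained by applying a linear map to all matrices. -/
def transformed (P : SDPData m n) (T : SymMat n ≃ₗ[ℝ] SymMat n) : SDPData m n :=
  ⟨fun i => T (P.a i), T P.b, P.c⟩

lemma transformed_op (P : SDPData m n) (T : SymMat n ≃ₗ[ℝ] SymMat n) (x : Fin m → ℝ) :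
    (P.transformed T).op x = T (P.op x) := by
  simp [op, transformed, map_sum]

lemma rowOp_one (P : SDPData m n) : P.rowOp 1 = P := by
  obtain ⟨a, b, c⟩ := P
  simp only [rowOp, mk.injEq, true_and]
  constructor
  · ext1 i
    rw [show (1 : Matrix (Fin m) (Fin m) ℝ) i = Pi.single i 1 from by
      ext j; rw [Matrix.one_eq_pi_single]]
    exact op_single _ i
  · ext1 i
    rw [show (1 : Matrix (Fin m) (Fin m) ℝ) i = Pi.single i 1 from by
      ext j; rw [Matrix.one_eq_pi_single]]
    exact obj_single _ i

lemma rowOp_op (P : SDPData m n) (M : Matrix (Fin m) (Fin m) ℝ) (x : Fin m → ℝ) :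
    (P.rowOp M).op x = P.op (∑ i, x i • M i) := by
  rw [← opL_apply P, map_sum]
  simp [op, rowOp]

lemma rowOp_obj (P : SDPData m n) (M : Matrix (Fin m) (Fin m) ℝ) (x : Fin m → ℝ) :
    (P.rowOp M).obj x = P.obj (∑ i, x i • M i) := by
  rw [map_sum, obj_apply]
  simp [rowOp, mul_comm]

lemma rowOp_mul (P : SDPData m n) (M N : Matrix (Fin m) (Fin m) ℝ) :
    (P.rowOp N).rowOp M = P.rowOp (M * N) := by
  have h : ∀ i, ∑ j, M i j • N j = (M * N) i := fun i => by
    ext l; simp [Matrix.mul_apply]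
  change (⟨fun i => (P.rowOp N).op (M i), P.b, fun i => (P.rowOp N).obj (M i)⟩ : SDPData m n) = _
  simp only [rowOp_op, rowOp_obj, h]
  rfl

variable {𝒯 : Set (SymMat n ≃ₗ[ℝ] SymMat n)}

lemma rowOp_updateRow (P : SDPData m n) (i : Fin m) (l : Fin m → ℝ) :
    P.rowOp ((1 : Matrix (Fin m) (Fin m) ℝ).updateRow i l) =
      ⟨Function.update P.a i (P.op l), P.b, Function.update P.c i (∑ j, P.c j * l j)⟩ := by
  have hone := P.rowOp_one
  rw [rowOp] at hone
  have ha : ∀ j, P.op ((1 : Matrix (Fin m) (Fin m) ℝ) j) = P.a j :=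
    fun j => congrFun (congrArg SDPData.a hone) j
  have hc : ∀ j, P.obj ((1 : Matrix (Fin m) (Fin m) ℝ) j) = P.c j :=
    fun j => congrFun (congrArg SDPData.c hone) j
  simp only [rowOp, mk.injEq, true_and]
  constructor
  · ext1 j
    rcases eq_or_ne j i with rfl | hj
    · rw [Function.update_self, Matrix.updateRow_self]
    · rw [Function.update_of_ne hj, Matrix.updateRow_ne hj, ha]
  · ext1 j
    rcases eq_or_ne j i with rfl | hj
    · rw [Function.update_self, Matrix.updateRow_self, obj_apply]
    · rw [Function.update_of_ne hj, Matrix.updateRow_ne hj, hc]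

lemma step_rowOp_updateRow (P : SDPData m n) (i : Fin m) (l : Fin m → ℝ) (hl : l i ≠ 0) :
    Step 𝒯 P (P.rowOp ((1 : Matrix (Fin m) (Fin m) ℝ).updateRow i l)) := by
  rw [rowOp_updateRow]
  exact Step.combine P i l hl

/-- Every invertible matrix of row operations is a composition of elementary ones. -/
lemma reflTransGen_rowOp (P : SDPData m n) (M : Matrix (Fin m) (Fin m) ℝ) (hM : M.det ≠ 0) :
    Relation.ReflTransGen (Step 𝒯) P (P.rowOp M) := by
  refine Matrix.diagonal_transvection_induction_of_det_ne_zero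
    (fun M => ∀ P : SDPData m n, Relation.ReflTransGen (Step 𝒯) P (P.rowOp M)) M hM ?_ ?_ ?_ P
  · intro D hD P
    rw [det_diagonal, Finset.prod_ne_zero_iff] at hD
    -- The diagonal entries are introduced one index at a time, each by rescaling a single row.
    have h : ∀ s : Finset (Fin m), Relation.ReflTransGen (Step 𝒯) P
        (P.rowOp (Matrix.diagonal fun i => if i ∈ s then D i else 1)) := by
      intro s
      induction s using Finset.induction_on with
      | empty =>
        simp only [Finset.notMem_empty, if_false, Matrix.diagonal_one, rowOp_one]
        exact Relation.ReflTransGen.refl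
      | insert i s his ih =>
        refine ih.tail ?_
        have h := step_rowOp_updateRow (𝒯 := 𝒯)
          (P.rowOp (Matrix.diagonal fun i => if i ∈ s then D i else 1)) i (Pi.single i (D i))
          (by simpa using hD i (Finset.mem_univ i))
        rw [rowOp_mul] at h
        convert h using 2
        ext j l
        rw [Matrix.mul_diagonal]
        rcases eq_or_ne j i with rfl | hj
        · rw [Matrix.updateRow_self]
          rcases eq_or_ne j l with rfl | hl
          · simp [his]
          · simp [hl, Ne.symm hl]
        · rw [Matrix.updateRow_ne hj]
          rcases eq_or_ne j l with rfl | hl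
          · simp [hj]
          · simp [hl]
    simpa using h Finset.univ
  · rintro ⟨i, j, hij, c⟩ P
    have h := step_rowOp_updateRow (𝒯 := 𝒯) P i ((1 : Matrix (Fin m) (Fin m) ℝ) i +
      c • (1 : Matrix (Fin m) (Fin m) ℝ) j) (by simp [Matrix.one_apply_ne hij.symm])
    refine Relation.ReflTransGen.single ?_
    rw [Matrix.TransvectionStruct.toMatrix, ← Matrix.updateRow_eq_transvection]
    exact h
  · intro A B _ _ hA hB P
    rw [← rowOp_mul]
    exact (hB P).trans (hA _)

end SDPData

/-- A linearly independent family extends to the rows of an invertible matrix. -/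
lemma exists_det_ne_zero_of_linearIndependent {m k : ℕ} (x : Fin k → Fin m → ℝ)
    (hx : LinearIndependent ℝ x) (hk : k ≤ m) :
    ∃ M : Matrix (Fin m) (Fin m) ℝ, M.det ≠ 0 ∧ ∀ i, M (Fin.castLE hk i) = x i := by
  obtain ⟨r, rfl⟩ := Nat.exists_eq_add_of_le hk
  let B := Module.Basis.sumExtend hx
  have hBx : ∀ i, B (Sum.inl i) = x i := fun i => by
    simp only [B, Module.Basis.sumExtend, Module.Basis.reindex_apply]
    change ((Module.Basis.extend hx.linearIndepOn_id) _ : Fin (k + r) → ℝ) = x i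
    rw [Module.Basis.extend_apply_self]
    rfl
  have hfin : Finite (Fin k ⊕ Module.Basis.sumExtendIndex hx) := Module.Finite.finite_basis B
  have : Finite (Module.Basis.sumExtendIndex hx) := Finite.sum_right (Fin k)
  have hcard : Nat.card (Module.Basis.sumExtendIndex hx) = r := by
    have h := Module.finrank_eq_nat_card_basis B
    rw [Nat.card_sum, Module.finrank_fin_fun, Nat.card_fin] at h
    omega
  let e : Fin (k + r) ≃ Fin k ⊕ Module.Basis.sumExtendIndex hx :=
    finSumFinEquiv.symm.trans ((Equiv.refl _).sumCongr (Finite.equivFinOfCardEq hcard).symm)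
  refine ⟨Matrix.of fun i => B (e i), ?_, fun i => ?_⟩
  · rw [← isUnit_iff_ne_zero, ← Matrix.isUnit_iff_isUnit_det,
      ← Matrix.linearIndependent_rows_iff_isUnit]
    exact B.linearIndependent.comp e e.injective
  · have : e (Fin.castLE hk i) = Sum.inl i := by
      simp only [e, Equiv.trans_apply]
      rw [show Fin.castLE hk i = Fin.castAdd r i from rfl, finSumFinEquiv_symm_apply_castAdd]
      rfl
    change B (e _) = _
    rw [this, hBx]

/-! ### Transport of feasibility along reformulations -/

namespace SDPData

variable {m n : ℕ}

/-- `Q` arises from `P` by an automorphism of the positive semidefinite cone, a shift of `b` and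
a surjective substitution of the variables. -/
def IsTransform (P Q : SDPData m n) : Prop :=
  ∃ T ∈ psdAut n, ∃ G : (Fin m → ℝ) → (Fin m → ℝ), Function.Surjective G ∧ ∃ μ : Fin m → ℝ,
    (∀ x, Q.op x = T (P.op (G x))) ∧ (∀ x, Q.obj x = P.obj (G x)) ∧ Q.b = T (P.b + P.op μ)

lemma refl_mem_psdAut : LinearEquiv.refl ℝ (SymMat n) ∈ psdAut n :=
  Set.image_id _

lemma op_zero (P : SDPData m n) : P.op 0 = 0 := P.opL.map_zero

lemma op_add (P : SDPData m n) (x y : Fin m → ℝ) : P.op (x + y) = P.op x + P.op y :=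
  P.opL.map_add x y

lemma op_smul (P : SDPData m n) (r : ℝ) (x : Fin m → ℝ) : P.op (r • x) = r • P.op x :=
  P.opL.map_smul r x

lemma Step.isTransform {P Q : SDPData m n} (h : Step (psdAut n) P Q) : P.IsTransform Q := by
  cases h with
  | combine i l hl =>
    set M := (1 : Matrix (Fin m) (Fin m) ℝ).updateRow i l with hM
    have hMu : IsUnit M := by
      -- Cramer's rule for the identity matrix shows that the determinant of `M` is `l i`.
      rw [Matrix.isUnit_iff_isUnit_det, hM, ← Matrix.cramer_transpose_apply, transpose_one,
        Matrix.cramer_one]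
      exact hl.isUnit
    rw [← rowOp_updateRow]
    refine ⟨_, refl_mem_psdAut, fun x => ∑ j, x j • M j, fun z => ?_, 0, ?_, ?_, ?_⟩
    · obtain ⟨x, hx⟩ := Matrix.vecMul_surjective_iff_isUnit.2 hMu z
      exact ⟨x, (Matrix.vecMul_eq_sum x M).symm.trans hx⟩
    · intro x
      rw [rowOp_op]
      rfl
    · intro x
      rw [rowOp_obj]
    · simp [op_zero, rowOp]
  | swap i j hij =>
    refine ⟨_, refl_mem_psdAut, fun x => x ∘ Equiv.swap i j, fun x => ?_, 0, ?_, ?_, ?_⟩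
    · exact ⟨x ∘ Equiv.swap i j, by ext; simp⟩
    · intro x
      simp only [op, LinearEquiv.refl_apply]
      exact Fintype.sum_equiv (Equiv.swap i j) _ _ fun r => by simp
    · intro x
      simp only [obj_apply]
      exact Fintype.sum_equiv (Equiv.swap i j) _ _ fun r => by simp
    · simp [op_zero]
  | shift μ =>
    exact ⟨_, refl_mem_psdAut, id, Function.surjective_id, μ, fun _ => rfl, fun _ => rfl, rfl⟩
  | transform T hT =>
    refine ⟨T, hT, id, Function.surjective_id, 0, fun x => P.transformed_op T x, fun _ => rfl, ?_⟩
    rw [op_zero, add_zero]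

/-- The inverse adjoint of an automorphism of the positive semidefinite cone maps the cone to
itself. -/
lemma exists_mem_psd_ip_eq {T : SymMat n ≃ₗ[ℝ] SymMat n} (hT : T ∈ psdAut n) {y : SymMat n}
    (hy : y ∈ psd n) : ∃ y' ∈ psd n, ∀ x, ip (T x) y' = ip x y := by
  obtain ⟨y', hy'⟩ := exists_ip_eq ((ipL n y).comp T.symm.toLinearMap)
  refine ⟨y', mem_psd_of_forall_ip_nonneg fun x hx => ?_, fun x => ?_⟩
  · rw [hy']
    have hT' : T '' psd n = psd n := hT
    rw [← hT'] at hx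
    obtain ⟨u, hu, rfl⟩ := hx
    simpa using ip_nonneg hy hu
  · rw [ip_comm, hy', ip_comm x]
    simp

variable {P Q : SDPData m n}

lemma IsTransform.dualFeasible (h : P.IsTransform Q) (hP : P.DualFeasible) : Q.DualFeasible := by
  obtain ⟨T, hT, G, hG, μ, h1, h2, h3⟩ := h
  obtain ⟨y, hy, hyc⟩ := hP
  obtain ⟨y', hy', hyy⟩ := exists_mem_psd_ip_eq hT hy
  refine ⟨y', hy', (adj_eq_c_iff _ _).2 fun x => ?_⟩
  rw [h1, hyy, (adj_eq_c_iff _ _).1 hyc, h2]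

lemma IsTransform.primalStronglyInfeasible (h : P.IsTransform Q)
    (hP : P.PrimalStronglyInfeasible) : Q.PrimalStronglyInfeasible := by
  obtain ⟨T, hT, G, hG, μ, h1, h2, h3⟩ := h
  obtain ⟨y, hy, hyc, hyb⟩ := hP
  obtain ⟨y', hy', hyy⟩ := exists_mem_psd_ip_eq hT hy
  rw [adj_eq_zero_iff] at hyc
  refine ⟨y', hy', (adj_eq_zero_iff _ _).2 fun x => ?_, ?_⟩
  · rw [h1, hyy, hyc]
  · rw [h3, hyy, ip_add_left, hyc, add_zero, hyb]

lemma map_mem_psd {T : SymMat n ≃ₗ[ℝ] SymMat n} (hT : T ∈ psdAut n) {x : SymMat n}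
    (hx : x ∈ psd n) : T x ∈ psd n := by
  have hT' : T '' psd n = psd n := hT
  rw [← hT']
  exact ⟨x, hx, rfl⟩

lemma IsTransform.primalFeasible (h : P.IsTransform Q) (hP : P.PrimalFeasible) :
    Q.PrimalFeasible := by
  obtain ⟨T, hT, G, hG, μ, h1, h2, h3⟩ := h
  obtain ⟨x, hx⟩ := hP
  -- The summand `μ` cancels the shift of `b`.
  obtain ⟨x', hx'⟩ := hG (x + μ)
  refine ⟨x', ?_⟩
  rw [h1, h3, hx', ← map_sub, op_add, add_sub_add_right_eq_sub]
  exact map_mem_psd hT hx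

lemma IsTransform.dualStronglyInfeasible (h : P.IsTransform Q) (hP : P.DualStronglyInfeasible) :
    Q.DualStronglyInfeasible := by
  obtain ⟨T, hT, G, hG, μ, h1, h2, h3⟩ := h
  obtain ⟨x, hx, hxc⟩ := hP
  obtain ⟨x', rfl⟩ := hG x
  refine ⟨x', ?_, ?_⟩
  · rw [h1]
    exact map_mem_psd hT hx
  · rw [← obj_apply, h2, obj_apply, hxc]

/-- Forward transport is enough: a certificate refutes `p Q`, and hence `p P`. -/
lemma IsReformulation.of_isTransform {p : SDPData m n → Prop}
    (hp : ∀ P Q : SDPData m n, P.IsTransform Q → p P → p Q) (h : P.IsReformulation Q) :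
    p P → p Q := by
  induction h with
  | refl => exact id
  | tail _ h ih => exact fun hP => hp _ _ h.isTransform (ih hP)

lemma IsRotReformulation.isReformulation (h : P.IsRotReformulation Q) : P.IsReformulation Q := by
  refine Relation.ReflTransGen.mono (fun P Q h => ?_) _ _ h
  cases h with
  | combine i l hl => exact Step.combine P i l hl
  | swap i j hij => exact Step.swap P i j hij
  | shift μ => exact Step.shift P μ
  | transform T hT => exact Step.transform P T (rotations_subset_psdAut hT)

end SDPData

/-! ### The four certificates -/

/-- The defining property of a facial reduction sequence for its last member. -/
lemma IsRegFR.ip_last_nonneg {n k : ℕ} {y : Fin (k + 1) → SymMat n} (hy : IsRegFR y)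
    {x : SymMat n} (hx : x ∈ psd n) (h : ∀ i : Fin k, ip (y i.castSucc) x = 0) :
    0 ≤ ip (y (Fin.last k)) x :=
  hy.isFR (Fin.last k) x ⟨hx, fun j hj => h ⟨j, hj⟩⟩

namespace SDPData

variable {m n : ℕ} {P Q : SDPData m n}

lemma IsDualRef.not_dualFeasible {k : ℕ} {hk : k + 1 ≤ m} (h : Q.IsDualRef k hk) :
    ¬ Q.DualFeasible := by
  rintro ⟨y, hy, hyc⟩
  obtain ⟨h0, h1, hreg⟩ := h
  have hip : ∀ i, ip (Q.lead (k + 1) hk i) y = Q.c (Fin.castLE hk i) :=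
    fun i => congrFun hyc (Fin.castLE hk i)
  have := hreg.ip_last_nonneg hy fun i => by rw [hip, h0]
  rw [hip, h1] at this
  linarith

lemma IsDualNotStrongCert.not_dualStronglyInfeasible {l : ℕ} {y : Fin (l + 1) → SymMat n}
    (h : Q.IsDualNotStrongCert y) : ¬ Q.DualStronglyInfeasible := by
  rintro ⟨x, hx, hxc⟩
  obtain ⟨hreg, h0, h1⟩ := h
  have := hreg.ip_last_nonneg hx fun i => by rw [ip_comm, (adj_eq_zero_iff _ _).1 (h0 i)]
  rw [ip_comm, (adj_eq_c_iff _ _).1 h1, obj_apply, hxc] at this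
  linarith

lemma IsPrimalInfeasCert.not_primalFeasible {k : ℕ} {y : Fin (k + 1) → SymMat n}
    (h : Q.IsPrimalInfeasCert y) : ¬ Q.PrimalFeasible := by
  rintro ⟨x, hx⟩
  obtain ⟨hreg, h0, h1, h2⟩ := h
  have := hreg.ip_last_nonneg hx fun i => by
    rw [ip_comm, ip_sub_left, (adj_eq_zero_iff _ _).1 (h0 i).1, (h0 i).2, sub_zero]
  rw [ip_comm, ip_sub_left, (adj_eq_zero_iff _ _).1 h1, h2] at this
  linarith

lemma not_primalStronglyInfeasible_of_isRegFR {l : ℕ} {hl : l ≤ m}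
    (hreg : IsRegFR (Q.leadSnoc l hl)) : ¬ Q.PrimalStronglyInfeasible := by
  rintro ⟨y, hy, hy0, hyb⟩
  have := hreg.ip_last_nonneg hy fun i => by
    rw [leadSnoc, Fin.snoc_castSucc]
    exact congrFun hy0 _
  rw [leadSnoc, Fin.snoc_last, hyb] at this
  linarith

lemma transform_step (P : SDPData m n) (t : (Matrix (Fin n) (Fin n) ℝ)ˣ) :
    Step (rotations n) P (P.transformed (rotation t)) :=
  Step.transform P _ (rotation_mem_rotations t)

/-- An infeasible dual system has a reformulation that shows its infeasibility. -/
lemma exists_isDualRef (hn : 1 ≤ n) (hP : ¬ P.DualFeasible) :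
    ∃ Q : SDPData m n, P.IsRotReformulation Q ∧ ∃ (k : ℕ) (hk : k + 1 ≤ m), Q.IsDualRef k hk ∧
      k ≤ n - 1 ∧ IsPreStrict (psd n) (Q.lead (k + 1) hk) := by
  obtain ⟨x₀, hx₀⟩ : ∃ x₀, P.obj x₀ = -1 := by
    have hc : ∃ x, P.obj x ≠ 0 := by
      by_contra hc
      push Not at hc
      exact hP ⟨0, zero_mem_psd, (adj_eq_c_iff _ _).2 fun x => by rw [hc, ip_comm, ip_zero_left]⟩
    obtain ⟨x, hx⟩ := hc
    exact ⟨(-(P.obj x)⁻¹) • x, by simp [hx]⟩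
  let R : Submodule ℝ (SymMat n) := (LinearMap.ker P.obj).map P.opL
  let L : Submodule ℝ (SymMat n) :=
    { carrier := {y | ∀ r ∈ R, ip r y = 0}
      add_mem' := fun hx hy r hr => by rw [ip_add_right, hx r hr, hy r hr, add_zero]
      zero_mem' := fun r _ => by rw [ip_comm, ip_zero_left]
      smul_mem' := fun c x hx r hr => by rw [ip_smul_right, hx r hr, mul_zero] }
  -- The vector `x + P.obj x • x₀` has objective value `0`. Hence on `L` the adjoint takes values in
  -- the multiples of `c`, with factor `-ip (P.op x₀) y`; a semidefinite `y` with positive factor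
  -- would scale to a dual solution.
  have hdec : ∀ y ∈ L, ∀ x, ip (P.op x) y = -(P.obj x * ip (P.op x₀) y) := fun y hy x => by
    have h := hy (P.op (x + P.obj x • x₀)) ⟨_, by simp [hx₀], rfl⟩
    rw [op_add, op_smul, ip_add_left, ip_smul_left] at h
    linarith
  obtain ⟨t, k, w, hkn, hreg, hpre, hli, hw, hwl⟩ := exists_regFR_certificate hn L
    (ipL n (P.op x₀)) (fun y hyL hy => by
      rw [ipL_apply]
      by_contra hneg
      rw [not_le] at hneg
      have hs : 0 ≤ (-(ip (P.op x₀) y))⁻¹ := by rw [inv_nonneg]; linarith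
      refine hP ⟨(-(ip (P.op x₀) y))⁻¹ • y, smul_mem_psd hy hs, (adj_eq_c_iff _ _).2 fun x => ?_⟩
      rw [ip_smul_right, hdec y hyL x]
      have hne := hneg.ne
      field_simp)
  have hmem : ∀ i : Fin k, ∃ x, P.obj x = 0 ∧ P.op x = w i.castSucc := fun i => by
    obtain ⟨x, hx, h⟩ := mem_of_ip_eq_zero R _ (hw i)
    exact ⟨x, hx, h⟩
  choose x hx0 hxw using hmem
  obtain ⟨v, hv0, hvw⟩ : ∃ v, P.obj v = -1 ∧ P.op v = w (Fin.last k) := by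
    obtain ⟨v, hv, h⟩ := mem_of_ip_eq_zero R (w (Fin.last k) - P.op x₀) fun y hy => by
      rw [ip_sub_left, hwl y hy, ipL_apply, sub_self]
    have hv' : P.obj v = 0 := hv
    refine ⟨v + x₀, by rw [map_add, hv', hx₀, zero_add], ?_⟩
    rw [op_add, ← opL_apply, h, sub_add_cancel]
  let X : Fin (k + 1) → Fin m → ℝ := Fin.snoc (α := fun _ => Fin m → ℝ) x v
  have hXw : ∀ i, P.op (X i) = w i := fun i => by
    refine Fin.lastCases ?_ (fun i => ?_) i
    · simp only [X, Fin.snoc_last, hvw]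
    · simp only [X, Fin.snoc_castSucc, hxw]
  -- The first `k` coefficient vectors are independent because their images are, and all have
  -- objective value `0`, whereas `v` has value `-1`. This independence also forces `k + 1 ≤ m`.
  have hXli : LinearIndependent ℝ X := by
    refine linearIndependent_finSnoc.2 ⟨?_, fun hmem => ?_⟩
    · refine LinearIndependent.of_comp P.opL ?_
      rwa [show P.opL ∘ x = fun i : Fin k => w i.castSucc from funext hxw]
    · have hle : Submodule.span ℝ (Set.range x) ≤ LinearMap.ker P.obj := by
        rw [Submodule.span_le]
        rintro _ ⟨i, rfl⟩
        exact hx0 i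
      have : P.obj v = 0 := hle hmem
      rw [hv0] at this
      norm_num at this
  have hkm : k + 1 ≤ m := by simpa using hXli.fintype_card_le_finrank
  obtain ⟨M, hM, hMX⟩ := exists_det_ne_zero_of_linearIndependent X hXli hkm
  have hlead : ((P.rowOp M).transformed (rotation t)).lead (k + 1) hkm =
      fun i => rotation t (w i) := by
    ext1 i
    change rotation t (P.op (M (Fin.castLE hkm i))) = _
    rw [hMX, hXw]
  have hc : ∀ i, ((P.rowOp M).transformed (rotation t)).c (Fin.castLE hkm i) = P.obj (X i) :=
    fun i => by
      change P.obj (M _) = _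
      rw [hMX]
  refine ⟨(P.rowOp M).transformed (rotation t),
    (P.reflTransGen_rowOp M hM).tail (transform_step _ t), k, hkm, ⟨fun i => ?_, ?_, ?_⟩, hkn, ?_⟩
  · rw [hc]
    simp only [X, Fin.snoc_castSucc, hx0]
  · rw [hc]
    simp only [X, Fin.snoc_last, hv0]
  · rwa [hlead]
  · rwa [hlead]

/-- A primal system that is not strongly infeasible has a reformulation that shows this. -/
lemma exists_isRegFR_leadSnoc (hn : 1 ≤ n) (hP : ¬ P.PrimalStronglyInfeasible) :
    ∃ Q : SDPData m n, P.IsRotReformulation Q ∧ ∃ (l : ℕ) (hl : l ≤ m),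
      IsRegFR (Q.leadSnoc l hl) ∧ l ≤ n - 1 ∧ IsPreStrict (psd n) (Q.leadSnoc l hl) := by
  let R : Submodule ℝ (SymMat n) := LinearMap.range P.opL
  let L : Submodule ℝ (SymMat n) :=
    { carrier := {y | ∀ r ∈ R, ip r y = 0}
      add_mem' := fun hx hy r hr => by rw [ip_add_right, hx r hr, hy r hr, add_zero]
      zero_mem' := fun r _ => by rw [ip_comm, ip_zero_left]
      smul_mem' := fun c x hx r hr => by rw [ip_smul_right, hx r hr, mul_zero] }
  -- Here `L` is the kernel of the adjoint: a semidefinite `y` in it with `ip P.b y < 0` would scale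
  -- to a certificate of strong infeasibility.
  obtain ⟨t, k, w, hkn, hreg, hpre, hli, hw, hwl⟩ := exists_regFR_certificate hn L
    (ipL n P.b) (fun y hyL hy => by
      rw [ipL_apply]
      by_contra hneg
      rw [not_le] at hneg
      have hs : 0 ≤ (-(ip P.b y))⁻¹ := by rw [inv_nonneg]; linarith
      refine hP ⟨(-(ip P.b y))⁻¹ • y, smul_mem_psd hy hs,
        (adj_eq_zero_iff _ _).2 fun x => ?_, ?_⟩
      · rw [ip_smul_right, hyL (P.op x) ⟨x, rfl⟩, mul_zero]
      · rw [ip_smul_right, inv_neg, neg_mul, inv_mul_cancel₀ hneg.ne])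
  have hmem : ∀ i : Fin k, ∃ x, P.op x = w i.castSucc :=
    fun i => mem_of_ip_eq_zero R _ (hw i)
  choose x hxw using hmem
  obtain ⟨μ, hμ⟩ : ∃ μ, P.op μ = w (Fin.last k) - P.b :=
    mem_of_ip_eq_zero R (w (Fin.last k) - P.b) fun y hy => by
      rw [ip_sub_left, hwl y hy, ipL_apply, sub_self]
  have hxli : LinearIndependent ℝ x := by
    refine LinearIndependent.of_comp P.opL ?_
    rwa [show P.opL ∘ x = fun i : Fin k => w i.castSucc from funext hxw]
  have hkm : k ≤ m := by simpa using hxli.fintype_card_le_finrank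
  obtain ⟨M, hM, hMx⟩ := exists_det_ne_zero_of_linearIndependent x hxli hkm
  let P₁ : SDPData m n := ⟨P.a, P.b + P.op μ, P.c⟩
  have hseq : ((P₁.rowOp M).transformed (rotation t)).leadSnoc k hkm =
      fun i => rotation t (w i) := by
    ext1 i
    refine Fin.lastCases ?_ (fun i => ?_) i
    · rw [leadSnoc, Fin.snoc_last]
      change rotation t (P.b + P.op μ) = _
      rw [hμ, add_sub_cancel]
    · rw [leadSnoc, Fin.snoc_castSucc]
      change rotation t (P.op (M (Fin.castLE hkm i))) = _
      rw [hMx, hxw]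
  refine ⟨(P₁.rowOp M).transformed (rotation t), ?_, k, hkm, by rwa [hseq], hkn, by rwa [hseq]⟩
  exact ((Relation.ReflTransGen.single (Step.shift P μ)).trans
    (P₁.reflTransGen_rowOp M hM)).tail (transform_step _ t)

/-- The rotation of the matrices of a semidefinite program that matches the rotation by `t` of the
dual variables. -/
lemma exists_dual_rotation (t : (Matrix (Fin n) (Fin n) ℝ)ˣ) :
    ∃ s : (Matrix (Fin n) (Fin n) ℝ)ˣ, ∀ x y, ip (rotation s x) (rotation t y) = ip x y := by
  refine ⟨⟨((t⁻¹ : (Matrix (Fin n) (Fin n) ℝ)ˣ) : Matrix (Fin n) (Fin n) ℝ)ᵀ,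
    (t : Matrix (Fin n) (Fin n) ℝ)ᵀ, by rw [← transpose_mul, Units.mul_inv, transpose_one],
    by rw [← transpose_mul, Units.inv_mul, transpose_one]⟩, fun x y => ?_⟩
  rw [rotation_apply, rotation_apply, ip_congr_left, transpose_transpose, congr_congr,
    Units.mul_inv, congr_one]

/-- A dual system that is not strongly infeasible has a reformulation with a certificate. -/
lemma exists_isDualNotStrongCert (hn : 1 ≤ n) (hP : ¬ P.DualStronglyInfeasible) :
    ∃ Q : SDPData m n, P.IsRotReformulation Q ∧ ∃ (l : ℕ) (y : Fin (l + 1) → SymMat n),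
      Q.IsDualNotStrongCert y ∧ l ≤ n - 1 ∧ IsPreStrict (psd n) y := by
  have hnonneg : ∀ x, P.op x ∈ psd n → 0 ≤ P.obj x := fun x hx => by
    by_contra hneg
    rw [not_le] at hneg
    have hs : 0 ≤ (-(P.obj x))⁻¹ := by rw [inv_nonneg]; linarith
    refine hP ⟨(-(P.obj x))⁻¹ • x, ?_, ?_⟩
    · rw [op_smul]
      exact smul_mem_psd hx hs
    · rw [← obj_apply, map_smul, smul_eq_mul, inv_neg, neg_mul, inv_mul_cancel₀ hneg.ne]
  -- On the kernel of `P.opL` both `x` and `-x` satisfy the hypothesis of `hnonneg`, so the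
  -- objective vanishes there and factors through `P.opL`.
  have hker : P.obj ∈ (LinearMap.ker P.opL).dualAnnihilator := by
    rw [Submodule.mem_dualAnnihilator]
    intro x hx
    have hx0 : P.op x = 0 := hx
    refine le_antisymm ?_ (hnonneg x (by rw [hx0]; exact zero_mem_psd))
    have := hnonneg (-x) (by
      rw [← opL_apply, map_neg, opL_apply, hx0, neg_zero]; exact zero_mem_psd)
    rw [map_neg] at this
    linarith
  rw [← LinearMap.range_dualMap_eq_dualAnnihilator_ker] at hker
  obtain ⟨z, hz⟩ := hker
  have hz' : ∀ x, z (P.op x) = P.obj x := fun x => LinearMap.congr_fun hz x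
  obtain ⟨t, k, w, hkn, hreg, hpre, hli, hw, hwl⟩ := exists_regFR_certificate hn
    (LinearMap.range P.opL) z (by
      rintro _ ⟨x, rfl⟩ hx
      rw [opL_apply, hz']
      exact hnonneg x hx)
  obtain ⟨s, hs⟩ := exists_dual_rotation t
  refine ⟨P.transformed (rotation s), Relation.ReflTransGen.single (transform_step P s), k,
    fun i => rotation t (w i), ⟨hreg, fun i => ?_, ?_⟩, hkn, hpre⟩
  · rw [adj_eq_zero_iff]
    intro x
    rw [transformed_op, hs, ip_comm]
    exact hw i _ ⟨x, rfl⟩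
  · rw [adj_eq_c_iff]
    intro x
    rw [transformed_op, hs, ip_comm, hwl (P.op x) ⟨x, rfl⟩, hz']
    rfl

/-- An infeasible primal system has a reformulation with a certificate. -/
lemma exists_isPrimalInfeasCert (hn : 1 ≤ n) (hP : ¬ P.PrimalFeasible) :
    ∃ Q : SDPData m n, P.IsRotReformulation Q ∧ ∃ (k : ℕ) (y : Fin (k + 1) → SymMat n),
      Q.IsPrimalInfeasCert y ∧ k ≤ n - 1 ∧ IsPreStrict (psd n) y := by
  have hb : P.b ∉ LinearMap.range P.opL := by
    rintro ⟨x, hx⟩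
    refine hP ⟨x, ?_⟩
    rw [← opL_apply, hx, sub_self]
    exact zero_mem_psd
  obtain ⟨f, hf, hfR⟩ := (LinearMap.range P.opL).exists_le_ker_of_notMem hb
  have hfop : ∀ x, f (P.op x) = 0 := fun x => hfR ⟨x, rfl⟩
  have hopmem : ∀ x, P.op x ∈ LinearMap.range P.opL ⊔ ℝ ∙ P.b :=
    fun x => Submodule.mem_sup_left ⟨x, rfl⟩
  have hbmem : P.b ∈ LinearMap.range P.opL ⊔ ℝ ∙ P.b :=
    Submodule.mem_sup_right (Submodule.mem_span_singleton_self _)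
  -- The functional is `0` on the range and `-1` at `P.b`. A semidefinite `P.op x + r • P.b` with `r
  -- > 0` would make `-r⁻¹ • x` primal feasible.
  obtain ⟨t, k, w, hkn, hreg, hpre, hli, hw, hwl⟩ := exists_regFR_certificate hn
    (LinearMap.range P.opL ⊔ ℝ ∙ P.b) (-((f P.b)⁻¹ • f)) (fun y hyL hy => by
      obtain ⟨_, ⟨x, rfl⟩, _, hr, rfl⟩ := Submodule.mem_sup.1 hyL
      obtain ⟨r, rfl⟩ := Submodule.mem_span_singleton.1 hr
      have hval : (-((f P.b)⁻¹ • f)) (P.opL x + r • P.b) = -r := by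
        simp [hfop]
        field_simp
      rw [hval]
      by_contra hneg
      have hr0 : 0 < r := by linarith
      refine hP ⟨(-r⁻¹) • x, ?_⟩
      have := smul_mem_psd hy (inv_nonneg.2 hr0.le)
      rw [smul_add, smul_smul, inv_mul_cancel₀ hr0.ne', one_smul] at this
      rwa [op_smul, neg_smul (r⁻¹) (P.op x), sub_neg_eq_add, add_comm])
  obtain ⟨s, hs⟩ := exists_dual_rotation t
  refine ⟨P.transformed (rotation s), Relation.ReflTransGen.single (transform_step P s), k,
    fun i => rotation t (w i), ⟨hreg, fun i => ⟨?_, ?_⟩, ?_, ?_⟩, hkn, hpre⟩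
  · rw [adj_eq_zero_iff]
    intro x
    rw [transformed_op, hs, ip_comm]
    exact hw i _ (hopmem x)
  · change ip (rotation s P.b) _ = 0
    rw [hs, ip_comm]
    exact hw i _ hbmem
  · rw [adj_eq_zero_iff]
    intro x
    rw [transformed_op, hs, ip_comm, hwl _ (hopmem x)]
    simp [hfop]
  · change ip (rotation s P.b) _ = -1
    rw [hs, ip_comm, hwl _ hbmem]
    simp [hf]

end SDPData

end SDPCert

theorem theorem4 (m n : ℕ) (hn : 1 ≤ n) (P : SDPData m n) :
    -- (1) infeasibility of the dual
    ((¬ P.DualFeasible ↔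
        ∃ Q : SDPData m n, P.IsReformulation Q ∧
          ∃ (k : ℕ) (hk : k + 1 ≤ m), Q.IsDualRef k hk) ∧
      (¬ P.DualFeasible →
        ∃ Q : SDPData m n, P.IsRotReformulation Q ∧
          ∃ (k : ℕ) (hk : k + 1 ≤ m), Q.IsDualRef k hk ∧
            k ≤ n - 1 ∧ IsPreStrict (psd n) (Q.lead (k + 1) hk))) ∧
    -- (2) the dual is not strongly infeasible
    ((¬ P.DualStronglyInfeasible ↔
        ∃ Q : SDPData m n, P.IsReformulation Q ∧
          ∃ (l : ℕ) (y : Fin (l + 1) → SymMat n), Q.IsDualNotStrongCert y) ∧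
      (¬ P.DualStronglyInfeasible →
        ∃ Q : SDPData m n, P.IsRotReformulation Q ∧
          ∃ (l : ℕ) (y : Fin (l + 1) → SymMat n), Q.IsDualNotStrongCert y ∧
            l ≤ n - 1 ∧ IsPreStrict (psd n) y)) ∧
    -- (3) infeasibility of the primal
    ((¬ P.PrimalFeasible ↔
        ∃ Q : SDPData m n, P.IsReformulation Q ∧
          ∃ (k : ℕ) (y : Fin (k + 1) → SymMat n), Q.IsPrimalInfeasCert y) ∧
      (¬ P.PrimalFeasible →
        ∃ Q : SDPData m n, P.IsRotReformulation Q ∧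
          ∃ (k : ℕ) (y : Fin (k + 1) → SymMat n), Q.IsPrimalInfeasCert y ∧
            k ≤ n - 1 ∧ IsPreStrict (psd n) y)) ∧
    -- (4) the primal is not strongly infeasible
    ((¬ P.PrimalStronglyInfeasible ↔
        ∃ Q : SDPData m n, P.IsReformulation Q ∧
          ∃ (l : ℕ) (hl : l ≤ m), IsRegFR (Q.leadSnoc l hl)) ∧
      (¬ P.PrimalStronglyInfeasible →
        ∃ Q : SDPData m n, P.IsRotReformulation Q ∧
          ∃ (l : ℕ) (hl : l ≤ m), IsRegFR (Q.leadSnoc l hl) ∧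
            l ≤ n - 1 ∧ IsPreStrict (psd n) (Q.leadSnoc l hl))) := by
  have hinv : ∀ {p : SDPData m n → Prop} {Q : SDPData m n},
      (∀ P Q : SDPData m n, P.IsTransform Q → p P → p Q) → P.IsReformulation Q → ¬ p Q → ¬ p P :=
    fun hp h hQ hP => hQ (SDPData.IsReformulation.of_isTransform hp h hP)
  refine ⟨⟨⟨fun h => ?_, ?_⟩, SDPData.exists_isDualRef hn⟩,
    ⟨⟨fun h => ?_, ?_⟩, SDPData.exists_isDualNotStrongCert hn⟩,
    ⟨⟨fun h => ?_, ?_⟩, SDPData.exists_isPrimalInfeasCert hn⟩,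
    ⟨⟨fun h => ?_, ?_⟩, SDPData.exists_isRegFR_leadSnoc hn⟩⟩
  · obtain ⟨Q, hPQ, k, hk, hQ, -⟩ := SDPData.exists_isDualRef hn h
    exact ⟨Q, hPQ.isReformulation, k, hk, hQ⟩
  · rintro ⟨Q, hPQ, k, hk, hQ⟩
    exact hinv (fun _ _ => SDPData.IsTransform.dualFeasible) hPQ hQ.not_dualFeasible
  · obtain ⟨Q, hPQ, l, y, hQ, -⟩ := SDPData.exists_isDualNotStrongCert hn h
    exact ⟨Q, hPQ.isReformulation, l, y, hQ⟩
  · rintro ⟨Q, hPQ, l, y, hQ⟩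
    exact hinv (fun _ _ => SDPData.IsTransform.dualStronglyInfeasible) hPQ
      hQ.not_dualStronglyInfeasible
  · obtain ⟨Q, hPQ, k, y, hQ, -⟩ := SDPData.exists_isPrimalInfeasCert hn h
    exact ⟨Q, hPQ.isReformulation, k, y, hQ⟩
  · rintro ⟨Q, hPQ, k, y, hQ⟩
    exact hinv (fun _ _ => SDPData.IsTransform.primalFeasible) hPQ hQ.not_primalFeasible
  · obtain ⟨Q, hPQ, l, hl, hQ, -⟩ := SDPData.exists_isRegFR_leadSnoc hn h
    exact ⟨Q, hPQ.isReformulation, l, hl, hQ⟩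
  · rintro ⟨Q, hPQ, l, hl, hQ⟩
    exact hinv (fun _ _ => SDPData.IsTransform.primalStronglyInfeasible) hPQ
      (SDPData.not_primalStronglyInfeasible_of_isRegFR hQ)
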